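/- **Theorem (Gradient consistency).** Let $\mathcal H$ be a finite-dimensional real Hilbert space, $\mathcal Y$ a real Banach space, $\mathcal K\subset\mathcal Y$ a nonempty closed convex cone with positive polar cone $\mathcal K^+=\{v^*\in\mathcal Y^*:\langle v^*,y\rangle\ge 0\ \forall y\in\mathcal K\}$, and let $\mathcal C\subset\mathcal Y^*$ be a nonempty weak$^*$-compact convex set with $\operatorname{cl}^{w^*}\operatorname{cone}\mathcal C=\mathcal K^+$. Let $m\ge 1$, let $\Phi:\mathcal H\times\mathbb R^m\to\mathcal Y$, and let $h:\mathcal H\to\mathbb R$ be convex and continuously differentiable, such that for every $v^*\in\mathcal C$ the function $(x,z)\mapsto\langle v^*,\Phi(x,z)\rangle+h(x)$ is convex on $\mathcal H\times\mathbb R^m$. Put $$S^h_\Phi(x,z)=\sup_{v^*\in\mathcal C}\{\langle v^*,\Phi(x,z)\rangle+h(x)\},\qquad S_\lambda(x,z)=\inf_{(x',z')}\Big\{S^h_\Phi(x',z')+\tfrac1{2\lambda}\big(\|x-x'\|^2+\|z-z'\|^2\big)\Big\}\quad(\lambda>0).$$ Let $\xi$ be a random vector in $\mathbb R^m$ with a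 continuous density $f_\xi$ satisfying $\lim_{\|z\|\to\infty}\|z\|^{m+1}f_\xi(z)=0$, and set $$\varphi(x)=\mathbb P(\Phi(x,\xi)\in-\mathcal K),\qquad \varphi_\lambda(x)=\mathbb P(S_\lambda(x,\xi)\le h(x)).$$ Let $L\in\mathbb R^{m\times m}$ be nonsingular, $\theta(r,v)=\frac{2\pi^{m/2}|\det L|}{\Gamma(m/2)}r^{m-1}f_\xi(rLv)$, and let $\bar x\in\mathcal H$ satisfy $S^h_\Phi(\bar x,0)<h(\bar x)$. Let $F(\bar x)=\{v\in\mathbb S^{m-1}:\exists r>0,\ S^h_\Phi(\bar x,rLv)=h(\bar x)\}$ be the set of finite directions, $I(\bar x)=\mathbb S^{m-1}\setminus F(\bar x)$, and $\rho(\bar x,v)=\sup\{r>0: S^h_\Phi(\bar x,rLv)\le h(\bar x)\}$. Assume: 1. ($\eta_\theta$-growth condition) for every $\bar v\in I(\bar x)$ there are $\eta_\theta:\mathbb R\times\mathbb S^{m-1}\to[0,\infty]$ with $r\,\theta(r,v)\,\eta_\theta(r,v)\to0$ as $r\to\infty$, $v\to\bar v$ (with the convention $0\cdot\infty=0$), and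 $\epsilon,l>0$ such that every element $x^*$ of the partial convex subdifferential $\partial_xS^h_\Phi(x,rLv)$ satisfies $\|x^*\|\le l\,\eta_\theta(r,v)$, for all $x\in\mathbb B_\epsilon(\bar x)$, $v\in\mathbb S^{m-1}\cap\mathbb B_\epsilon(\bar v)$ and $r\ge l$; 2. for almost every $v\in\mathbb S^{m-1}$ (with respect to surface measure), if $v\in F(\bar x)$, then the convex subdifferential $\partial S^h_\Phi(\bar x,\rho(\bar x,v)Lv)$ is a singleton. Then $\varphi$ is Lipschitz on a neighbourhood of $\bar x$ and Fréchet differentiable at $\bar x$. Moreover, for all sequences $\lambda_k\to0$ with $\lambda_k>0$ and $x_k\to\bar x$, the function $\varphi_{\lambda_k}$ is differentiable at $x_k$ for all large $k$, and every accumulation point of $(\nabla\varphi_{\lambda_k}(x_k))_k$ equals $\nabla\varphi(\bar x)$. -/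

import Mathlib

open Set Filter Topology MeasureTheory
open scoped ENNReal NNReal

namespace ConicChance

noncomputable section

/-- The random space `ℝ^m`, with its Euclidean norm. -/
abbrev Rm (m : ℕ) : Type := EuclideanSpace ℝ (Fin m)

/-- The unit sphere `𝕊^{m-1}` of `ℝ^m`. -/
abbrev Sph (m : ℕ) : Type := Metric.sphere (0 : Rm m) 1

/-- The convex subdifferential of a real-valued function on a Hilbert space. -/
def subdiff {E : Type*} [NormedAddCommGroup E] [InnerProductSpace ℝ E]
    (ψ : E → ℝ) (x : E) : Set E :=
  {s | ∀ y, ψ x + inner ℝ s (y - x) ≤ ψ y}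

/-- The Moreau envelope of parameter `lam`. For `lam > 0` and `ψ` convex and continuous the family
under the infimum is bounded below, so that the infimum is the genuine one. -/
def moreau {E : Type*} [NormedAddCommGroup E] (ψ : E → ℝ) (lam : ℝ) (x : E) : ℝ :=
  ⨅ z : E, (ψ z + 1 / (2 * lam) * ‖x - z‖ ^ 2)

variable {H : Type*} [NormedAddCommGroup H] [InnerProductSpace ℝ H]
variable {Y : Type*} [NormedAddCommGroup Y] [NormedSpace ℝ Y]
variable {m : ℕ}

/-- `C` generates the positive polar cone of `K`: the weak-star closure of
`cone C = {t w : t ≥ 0, w ∈ C}` is `K⁺ = {w : ⟨w, y⟩ ≥ 0 for all y ∈ K}`. -/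
def GeneratesPolar (C : Set (WeakDual ℝ Y)) (K : ProperCone ℝ Y) : Prop :=
  closure {w : WeakDual ℝ Y | ∃ t : ℝ, 0 ≤ t ∧ ∃ c ∈ C, w = t • c}
    = {w : WeakDual ℝ Y | ∀ y ∈ K, 0 ≤ w y}

/-- The supremum function `S(x,z) = sup {⟨w, Φ(x,z)⟩ + h(x) : w ∈ C}` on the Hilbert product
`H × ℝ^m` (with norm `‖(x,z)‖² = ‖x‖² + ‖z‖²`). -/
def supFun (C : Set (WeakDual ℝ Y)) (Φ : H → Rm m → Y) (h : H → ℝ)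
    (p : WithLp 2 (H × Rm m)) : ℝ :=
  sSup ((fun w : WeakDual ℝ Y => w (Φ p.fst p.snd) + h p.fst) '' C)

/-- The point `(x, z)` of the Hilbert product `H × ℝ^m`. -/
def pt (x : H) (z : Rm m) : WithLp 2 (H × Rm m) := WithLp.toLp 2 (x, z)

/-- The probability function `φ(x) = ℙ(Φ(x,ξ) ∈ -K)`. -/
def prob {Ω : Type*} [MeasurableSpace Ω] (P : Measure Ω) (ξ : Ω → Rm m)
    (Φ : H → Rm m → Y) (K : ProperCone ℝ Y) (x : H) : ℝ :=
  P.real {ω | -(Φ x (ξ ω)) ∈ K}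

/-- The inner regularization `φ_lam(x) = ℙ(S_lam(x,ξ) ≤ h(x))`, where `S_lam` is the Moreau
envelope of `S` in both variables. -/
def probReg {Ω : Type*} [MeasurableSpace Ω] (P : Measure Ω) (ξ : Ω → Rm m)
    (S : WithLp 2 (H × Rm m) → ℝ) (h : H → ℝ) (lam : ℝ) (x : H) : ℝ :=
  P.real {ω | moreau S lam (pt x (ξ ω)) ≤ h x}

/-- The point `r L v` of `ℝ^m`. -/
def ray (L : Matrix (Fin m) (Fin m) ℝ) (r : ℝ) (v : Sph m) : Rm m :=
  r • Matrix.toEuclideanLin L (v : Rm m)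

/-- The density-like function
`θ(r,v) = (2 π^{m/2} |det L| / Γ(m/2)) r^{m-1} f(r L v)`. -/
def theta (L : Matrix (Fin m) (Fin m) ℝ) (f : Rm m → ℝ) (r : ℝ) (v : Sph m) : ℝ :=
  2 * Real.pi ^ ((m : ℝ) / 2) * |L.det| / Real.Gamma ((m : ℝ) / 2)
    * r ^ (m - 1) * f (ray L r v)

/-- The finite directions at `x`. -/
def finDir (S : WithLp 2 (H × Rm m) → ℝ) (h : H → ℝ) (L : Matrix (Fin m) (Fin m) ℝ)
    (x : H) : Set (Sph m) :=
  {v | ∃ r : ℝ, 0 < r ∧ S (pt x (ray L r v)) = h x}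

/-- The infinite directions at `x`. -/
def infDir (S : WithLp 2 (H × Rm m) → ℝ) (h : H → ℝ) (L : Matrix (Fin m) (Fin m) ℝ)
    (x : H) : Set (Sph m) :=
  (finDir S h L x)ᶜ

/-- The radial function `ρ(x,v) = sup {r > 0 : S(x, r L v) ≤ h(x)}`. It is only used for finite
directions `v`, where (if `S(x,0) < h(x)` and `S` is convex) the supremum is finite. -/
def rho (S : WithLp 2 (H × Rm m) → ℝ) (h : H → ℝ) (L : Matrix (Fin m) (Fin m) ℝ)
    (x : H) (v : Sph m) : ℝ :=
  sSup {r : ℝ | 0 < r ∧ S (pt x (ray L r v)) ≤ h x}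

/-- The `η_θ`-growth condition of `S` at `(x₀, v₀)`: there is `η : ℝ × 𝕊^{m-1} → [0,∞]` with
`r θ(r,v) η(r,v) → 0` as `r → ∞`, `v → v₀`, and there are `ε, l > 0` such that every element of
the partial subdifferential of `S` with respect to `x` at `(x, r L v)` has norm at most `l η(r,v)`,
for all `x ∈ 𝔹_ε(x₀)`, `v ∈ 𝔹_ε(v₀)` and `r ≥ l`. -/
def EtaGrowth (S : WithLp 2 (H × Rm m) → ℝ) (L : Matrix (Fin m) (Fin m) ℝ) (f : Rm m → ℝ)
    (x₀ : H) (v₀ : Sph m) : Prop :=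
  ∃ η : ℝ → Sph m → ℝ≥0∞,
    Tendsto (fun q : ℝ × Sph m => ENNReal.ofReal (q.1 * theta L f q.1 q.2) * η q.1 q.2)
      (atTop ×ˢ 𝓝 v₀) (𝓝 0) ∧
    ∃ ε l : ℝ, 0 < ε ∧ 0 < l ∧
      ∀ x ∈ Metric.closedBall x₀ ε, ∀ v ∈ Metric.closedBall v₀ ε, ∀ r : ℝ, l ≤ r →
        ∀ s ∈ subdiff (fun x' => S (pt x' (ray L r v))) x,
          ENNReal.ofReal ‖s‖ ≤ ENNReal.ofReal l * η r v

end

end ConicChance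

set_option linter.unusedSectionVars false

namespace ConicChance

/-! ### Subgradients and Moreau envelopes in finite dimension -/

section ConvexAnalysis

variable {E : Type*} [NormedAddCommGroup E] [InnerProductSpace ℝ E]

/-! Separation in `Y` turns the event `-Φ(x,ξ) ∈ K` into `S(x,ξ) ≤ h(x)`, where `S` is a finite
convex function. In polar coordinates adapted to `L`, the probability is an integral over the sphere
of the mass that each ray `a = L v` puts on the feasible set. By the Slater condition this set is,
on each ray, a segment issuing from the origin.

The central device is to describe the end of the segment by the inverse radius `τ(x,a)`, which is
`0` on unbounded rays, instead of the radius. A convexity argument from the Slater point shows that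
`τ` is Lipschitz in `x`, uniformly in `a = L v`, and unbounded rays need no separate treatment. In
the variable `u = 1/r` the radial density is `u^{-(m+1)} f(a/u)`. The tail condition on `f` says
exactly that it extends continuously by `0` to `u = 0`. The mass of a ray is therefore a `C¹`
function of `τ` whose derivative vanishes at `τ = 0`. It is Lipschitz in `x`, it is differentiable
with derivative zero where `τ = 0`, and where `τ > 0` implicit differentiation applies as soon as
the subgradient is unique. A Lipschitz constant common to all rays permits differentiation under the
integral (`IsSlaterRadius.hasFDerivAt_feasProb`).

The constants in this argument serve every convex minorant of `S` at once (`exists_isSlaterRadius`),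
in particular all Moreau envelopes. These are differentiable and converge to `S` along convergent
base points, so their gradients converge wherever the subgradient of `S` is unique. The derivatives
of the ray masses then converge for almost every direction (`tendsto_radialMassDeriv`), and
dominated convergence gives convergence of the gradients of the regularized probabilities. -/

theorem inner_add_sq_ge {lam : ℝ} (hlam : 0 < lam) (s d : E) :
    -(lam / 2 * ‖s‖ ^ 2) ≤ inner ℝ s d + 1 / (2 * lam) * ‖d‖ ^ 2 := by
  have h1 := neg_le_of_abs_le (abs_real_inner_le_norm s d)
  have h2 : 0 ≤ 1 / (2 * lam) * (lam * ‖s‖ - ‖d‖) ^ 2 := by positivity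
  have h3 : 1 / (2 * lam) * (lam * ‖s‖ - ‖d‖) ^ 2
    = lam / 2 * ‖s‖ ^ 2 - ‖s‖ * ‖d‖ + 1 / (2 * lam) * ‖d‖ ^ 2 := by
    field_simp
    ring
  linarith

/-- A subgradient at `p` bounds the proximal objective from below at every base point. -/
theorem prox_objective_ge {ψ : E → ℝ} {p s : E} (hs : s ∈ subdiff ψ p) {lam : ℝ} (hlam : 0 < lam)
    (x q : E) : ψ p + inner ℝ s (x - p) - lam / 2 * ‖s‖ ^ 2
      ≤ ψ q + 1 / (2 * lam) * ‖x - q‖ ^ 2 := by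
  have h1 := hs q
  have h2 := inner_add_sq_ge hlam s (q - x)
  have h3 : q - p = (x - p) + (q - x) := by abel
  rw [h3, inner_add_right] at h1
  rw [norm_sub_rev x q]
  linarith

theorem le_moreau {ψ : E → ℝ} {p s : E} (hs : s ∈ subdiff ψ p) {lam : ℝ} (hlam : 0 < lam) (x : E) :
    ψ p + inner ℝ s (x - p) - lam / 2 * ‖s‖ ^ 2 ≤ moreau ψ lam x :=
  le_ciInf fun q => prox_objective_ge hs hlam x q

variable [FiniteDimensional ℝ E]

theorem continuous_of_convexOn {ψ : E → ℝ} (hψ : ConvexOn ℝ univ ψ) : Continuous ψ :=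
  hψ.locallyLipschitz.continuous

/-- Separate `(x, ψ x)` from the open strict epigraph; the separating functional is negative on the
vertical direction, and normalizing by that value yields a subgradient. -/
theorem subdiff_nonempty {ψ : E → ℝ} (hψ : ConvexOn ℝ univ ψ) (x : E) :
    (subdiff ψ x).Nonempty := by
  have hc := continuous_of_convexOn hψ
  have hopen : IsOpen {p : E × ℝ | p.1 ∈ (univ : Set E) ∧ ψ p.1 < p.2} := by
    simpa using isOpen_lt (hc.comp continuous_fst) continuous_snd
  obtain ⟨l, hl⟩ := geometric_hahn_banach_open_point hψ.convex_strict_epigraph hopen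
    (x := (x, ψ x)) (by simp)
  have key : ∀ (y : E) (t : ℝ), l (y, t) = l (y, 0) + t * l (0, 1) := by
    intro y t
    have : ((y, t) : E × ℝ) = (y, 0) + t • (0, 1) := by simp
    rw [this, map_add, map_smul, smul_eq_mul]
  have hneg : l (0, 1) < 0 := by
    have := hl (x, ψ x + 1) (by simp)
    rw [key, key x (ψ x)] at this
    linarith
  set b := -l (0, 1) with hb
  have hbpos : 0 < b := by linarith
  have hle : ∀ y, l (y, 0) - b * ψ y ≤ l (x, 0) - b * ψ x := by
    intro y
    refine le_of_forall_pos_lt_add fun ε hε => ?_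
    -- The separation covers only points strictly above the graph; the height `ε / b` costs exactly
    -- `ε` after multiplication by `b`.
    have := hl (y, ψ y + ε / b) (by simp; positivity)
    rw [key, key x (ψ x)] at this
    have h2 : b * (ε / b) = ε := by field_simp
    have h3 : l (0, 1) = -b := by simp [hb]
    rw [h3] at this
    nlinarith
  let g : E →L[ℝ] ℝ := b⁻¹ • l.comp (ContinuousLinearMap.inl ℝ E ℝ)
  refine ⟨(InnerProductSpace.toDual ℝ E).symm g, fun y => ?_⟩
  rw [InnerProductSpace.toDual_symm_apply, map_sub]
  have h1 : ∀ z, g z = b⁻¹ * l (z, 0) := fun z => by simp [g]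
  rw [h1, h1]
  have h2 := mul_le_mul_of_nonneg_left (hle y) (inv_nonneg.2 hbpos.le)
  have h3 : ∀ z, b⁻¹ * (l (z, 0) - b * ψ z) = b⁻¹ * l (z, 0) - ψ z := fun z => by field_simp
  rw [h3, h3] at h2
  linarith

theorem bddBelow_prox_objective {ψ : E → ℝ} (hψ : ConvexOn ℝ univ ψ) {lam : ℝ} (hlam : 0 < lam)
    (x : E) : BddBelow (range fun q => ψ q + 1 / (2 * lam) * ‖x - q‖ ^ 2) := by
  obtain ⟨s, hs⟩ := subdiff_nonempty hψ x
  exact ⟨_, by rintro _ ⟨q, rfl⟩; exact prox_objective_ge hs hlam x q⟩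

theorem moreau_le {ψ : E → ℝ} (hψ : ConvexOn ℝ univ ψ) {lam : ℝ} (hlam : 0 < lam) (x q : E) :
    moreau ψ lam x ≤ ψ q + 1 / (2 * lam) * ‖x - q‖ ^ 2 :=
  ciInf_le (bddBelow_prox_objective hψ hlam x) q

theorem moreau_le_self {ψ : E → ℝ} (hψ : ConvexOn ℝ univ ψ) {lam : ℝ} (hlam : 0 < lam) (x : E) :
    moreau ψ lam x ≤ ψ x := by
  simpa using moreau_le hψ hlam x x

theorem exists_prox {ψ : E → ℝ} (hψ : ConvexOn ℝ univ ψ) {lam : ℝ} (hlam : 0 < lam) (x : E) :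
    ∃ q, moreau ψ lam x = ψ q + 1 / (2 * lam) * ‖x - q‖ ^ 2 := by
  have hc := continuous_of_convexOn hψ
  obtain ⟨s, hs⟩ := subdiff_nonempty hψ x
  have hlim : Tendsto (fun q => ψ q + 1 / (2 * lam) * ‖x - q‖ ^ 2) (cocompact E) atTop := by
    have h1 : Tendsto (fun q => ‖x - q‖) (cocompact E) atTop := by
      have := tendsto_norm_cocompact_atTop.comp
        (Homeomorph.subLeft x).isClosedEmbedding.tendsto_cocompact
      simpa [Function.comp_def] using this
    refine tendsto_atTop_mono (f := fun q => ψ x - lam * ‖s‖ ^ 2 + 1 / (4 * lam) * ‖x - q‖ ^ 2)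
      (fun q => ?_) ?_
    -- Half of the quadratic term absorbs the linear minorant; the other half remains and gives
    -- coercivity.
    · have := prox_objective_ge hs (lam := 2 * lam) (by positivity) x q
      simp only [sub_self, inner_zero_right] at this
      have h3 : 1 / (2 * lam) * ‖x - q‖ ^ 2 = 2 * (1 / (4 * lam) * ‖x - q‖ ^ 2) := by
        field_simp; ring
      have h4 : 1 / (2 * (2 * lam)) * ‖x - q‖ ^ 2 = 1 / (4 * lam) * ‖x - q‖ ^ 2 := by ring_nf
      have h5 : 0 ≤ 1 / (4 * lam) * ‖x - q‖ ^ 2 := by positivity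
      rw [h4] at this
      rw [h3]
      linarith
    · refine tendsto_atTop_add_const_left _ _ (Tendsto.const_mul_atTop (by positivity) ?_)
      exact (tendsto_pow_atTop (two_ne_zero)).comp h1
  obtain ⟨q, hq⟩ := (show Continuous fun q => ψ q + 1 / (2 * lam) * ‖x - q‖ ^ 2 by
    fun_prop).exists_forall_le hlim
  exact ⟨q, le_antisymm (moreau_le hψ hlam x q) (le_ciInf hq)⟩

/-- The same convex combination of the two proximal points is a competitor at the combined base
point. -/
theorem convexOn_moreau {ψ : E → ℝ} (hψ : ConvexOn ℝ univ ψ) {lam : ℝ} (hlam : 0 < lam) :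
    ConvexOn ℝ univ (moreau ψ lam) := by
  refine ⟨convex_univ, fun x _ y _ a b ha hb hab => ?_⟩
  obtain ⟨p, hp⟩ := exists_prox hψ hlam x
  obtain ⟨q, hq⟩ := exists_prox hψ hlam y
  refine (moreau_le hψ hlam _ (a • p + b • q)).trans ?_
  have h1 := hψ.2 (mem_univ p) (mem_univ q) ha hb hab
  have hsq : ConvexOn ℝ univ (fun z : E => ‖z‖ ^ 2) :=
    (convexOn_norm convex_univ).pow (fun _ _ => norm_nonneg _) 2
  have h2 := hsq.2 (mem_univ (x - p)) (mem_univ (y - q)) ha hb hab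
  have h3 : a • x + b • y - (a • p + b • q) = a • (x - p) + b • (y - q) := by
    simp only [smul_sub]; abel
  rw [hp, hq, h3]
  simp only [smul_eq_mul] at h1 h2 ⊢
  have h4 := mul_le_mul_of_nonneg_left h2 (show 0 ≤ 1 / (2 * lam) by positivity)
  linarith

/-- Keeping the proximal point of `x` as competitor gives a quadratic upper bound that touches at
`x`; convexity reflects it into a quadratic lower bound with the same linear part. -/
theorem differentiable_moreau {ψ : E → ℝ} (hψ : ConvexOn ℝ univ ψ) {lam : ℝ} (hlam : 0 < lam) :
    Differentiable ℝ (moreau ψ lam) := by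
  intro x
  obtain ⟨q, hq⟩ := exists_prox hψ hlam x
  set s : E := (1 / lam) • (x - q) with hs
  have hup : ∀ d, moreau ψ lam (x + d) ≤
      moreau ψ lam x + inner ℝ s d + 1 / (2 * lam) * ‖d‖ ^ 2 := by
    intro d
    have h1 := moreau_le hψ hlam (x + d) q
    have h2 : x + d - q = (x - q) + d := by abel
    rw [h2, norm_add_sq_real] at h1
    have h3 : inner ℝ s d = 1 / lam * inner ℝ (x - q) d := by rw [hs, real_inner_smul_left]
    rw [hq, h3]
    have h4 : 1 / (2 * lam) * (‖x - q‖ ^ 2 + 2 * inner ℝ (x - q) d + ‖d‖ ^ 2) =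
      1 / (2 * lam) * ‖x - q‖ ^ 2 + 1 / lam * inner ℝ (x - q) d + 1 / (2 * lam) * ‖d‖ ^ 2 := by
      field_simp
    linarith
  have hconv := convexOn_moreau hψ hlam
  have hlow : ∀ d, moreau ψ lam x + inner ℝ s d - 1 / (2 * lam) * ‖d‖ ^ 2
      ≤ moreau ψ lam (x + d) := by
    intro d
    have h1 := hconv.2 (mem_univ (x + d)) (mem_univ (x + -d)) (by norm_num : (0 : ℝ) ≤ 1 / 2)
      (by norm_num : (0 : ℝ) ≤ 1 / 2) (by norm_num)
    have h2 : (1 / 2 : ℝ) • (x + d) + (1 / 2 : ℝ) • (x + -d) = x := by module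
    rw [h2] at h1
    have h3 := hup (-d)
    rw [inner_neg_right, norm_neg] at h3
    simp only [smul_eq_mul] at h1
    linarith
  have : HasFDerivAt (moreau ψ lam) (innerSL ℝ s) x := by
    rw [hasFDerivAt_iff_isLittleO_nhds_zero]
    refine Asymptotics.IsBigO.trans_isLittleO (g := fun d : E => ‖d‖ ^ 2) ?_ ?_
    · refine Asymptotics.IsBigO.of_bound (1 / (2 * lam)) (Eventually.of_forall fun d => ?_)
      rw [Real.norm_eq_abs, norm_pow, norm_norm, abs_le]
      have := hup d
      have := hlow d
      rw [innerSL_apply_apply]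
      constructor <;> linarith
    · exact ((Asymptotics.isLittleO_pow_id (𝕜 := ℝ) one_lt_two).comp_tendsto
        (tendsto_norm_zero (E := E))).of_norm_right
  exact this.differentiableAt

/-- For a subgradient `s`, the function `ψ - ⟨s, ·⟩` is minimal at `x`, so `s` must be the gradient.
-/
theorem gradient_mem_subdiff {ψ : E → ℝ} (hψ : ConvexOn ℝ univ ψ) {x : E}
    (hd : DifferentiableAt ℝ ψ x) : gradient ψ x ∈ subdiff ψ x := by
  obtain ⟨s, hs⟩ := subdiff_nonempty hψ x
  have hmin : IsLocalMin (fun y => ψ y - inner ℝ s y) x := by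
    refine Eventually.of_forall fun y => ?_
    have := hs y
    rw [inner_sub_right] at this
    linarith
  have hder : HasFDerivAt (fun y => ψ y - inner ℝ s y) (fderiv ℝ ψ x - innerSL ℝ s) x :=
    hd.hasFDerivAt.sub (innerSL ℝ s).hasFDerivAt
  have h0 := hmin.hasFDerivAt_eq_zero hder
  have h1 : gradient ψ x = s := by
    rw [gradient, sub_eq_zero.1 h0]
    exact (InnerProductSpace.toDual ℝ E).symm_apply_apply s
  rwa [h1]

/-- Subgradients of minorants converging at the base points converge to the unique subgradient
of the limit. -/
theorem tendsto_subgradient {ι : Type*} {l : Filter ι} {ψ : E → ℝ} (hψ : ConvexOn ℝ univ ψ)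
    {p s : E} (huniq : ∀ s' ∈ subdiff ψ p, s' = s) {ψk : ι → E → ℝ} {pk sk : ι → E}
    (hle : ∀ᶠ k in l, ∀ q, ψk k q ≤ ψ q) (hp : Tendsto pk l (𝓝 p))
    (hval : Tendsto (fun k => ψk k (pk k)) l (𝓝 (ψ p)))
    (hsk : ∀ᶠ k in l, sk k ∈ subdiff (ψk k) (pk k)) : Tendsto sk l (𝓝 s) := by
  have hc := continuous_of_convexOn hψ
  obtain ⟨M, hM⟩ := (isCompact_closedBall p 2).exists_bound_of_continuousOn hc.continuousOn
  have hbound : ∀ᶠ k in l, sk k ∈ Metric.closedBall (0 : E) (M + |ψ p| + 1) := by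
    have h1 : ∀ᶠ k in l, dist (pk k) p < 1 := Metric.tendsto_nhds.1 hp 1 one_pos
    have h2 : ∀ᶠ k in l, dist (ψk k (pk k)) (ψ p) < 1 := Metric.tendsto_nhds.1 hval 1 one_pos
    filter_upwards [hle, hsk, h1, h2] with k k1 k2 k3 k4
    rw [mem_closedBall_zero_iff]
    by_cases hz : sk k = 0
    · rw [hz, norm_zero]
      have := (norm_nonneg _).trans (hM p (by simp))
      positivity
    -- A unit step in the direction of the subgradient raises the minorant by the norm of that
    -- subgradient, while `ψ` stays below `M` on the ball of radius `2`.
    set d : E := ‖sk k‖⁻¹ • sk k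
    have hn : 0 < ‖sk k‖ := norm_pos_iff.2 hz
    have hd : ‖d‖ = 1 := by simp [d, norm_smul, hn.ne']
    have h5 := (k2 (pk k + d)).trans (k1 _)
    rw [add_sub_cancel_left] at h5
    have h6 : inner ℝ (sk k) d = ‖sk k‖ := by
      simp only [d, real_inner_smul_right, real_inner_self_eq_norm_sq]
      field_simp
    have h7 : ψ (pk k + d) ≤ M := by
      refine (le_abs_self _).trans (hM _ ?_)
      rw [mem_closedBall_iff_norm]
      have : pk k + d - p = (pk k - p) + d := by abel
      rw [this]
      refine (norm_add_le _ _).trans ?_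
      rw [hd, ← dist_eq_norm]
      linarith
    rw [Real.dist_eq, abs_lt] at k4
    have := neg_abs_le (ψ p)
    rw [h6] at h5
    linarith
  refine (isCompact_closedBall (0 : E) _).tendsto_nhds_of_unique_mapClusterPt hbound
    fun s' _ hs' => huniq s' fun q => ?_
  obtain ⟨u, hu, hus⟩ := mapClusterPt_iff_ultrafilter.1 hs'
  have h1 : Tendsto (fun k => ψk k (pk k) + inner ℝ (sk k) (q - pk k)) u
      (𝓝 (ψ p + inner ℝ s' (q - p))) :=
    (hval.mono_left hu).add (hus.inner (tendsto_const_nhds.sub (hp.mono_left hu)))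
  refine le_of_tendsto h1 ?_
  filter_upwards [hu hle, hu hsk] with k k1 k2
  exact (k2 q).trans (k1 q)

/-- The remainder at `y` lies between `0` and `⟨g y - s, y - p⟩` for a subgradient `g y` at `y`, and
`g y → s` by uniqueness. -/
theorem hasFDerivAt_of_unique_subgradient {ψ : E → ℝ} (hψ : ConvexOn ℝ univ ψ) {p s : E}
    (hs : s ∈ subdiff ψ p) (huniq : ∀ s' ∈ subdiff ψ p, s' = s) :
    HasFDerivAt ψ (innerSL ℝ s) p := by
  have hc := continuous_of_convexOn hψ
  choose g hg using subdiff_nonempty hψ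
  have hlim : Tendsto g (𝓝 p) (𝓝 s) :=
    tendsto_subgradient hψ huniq (ψk := fun _ => ψ) (Eventually.of_forall fun _ _ => le_rfl)
      tendsto_id (hc.tendsto p) (Eventually.of_forall hg)
  rw [hasFDerivAt_iff_isLittleO, Asymptotics.isLittleO_iff]
  intro ε hε
  filter_upwards [Metric.tendsto_nhds.1 hlim ε hε] with y hy
  rw [innerSL_apply_apply, Real.norm_eq_abs, abs_of_nonneg (by linarith [hs y])]
  have h1 := hg y p
  have h2 : inner ℝ (g y) (p - y) = -inner ℝ (g y) (y - p) := by
    rw [← inner_neg_right, neg_sub]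
  have h3 : ψ y - ψ p - inner ℝ s (y - p) ≤ inner ℝ (g y - s) (y - p) := by
    rw [inner_sub_left]; linarith
  refine h3.trans ((real_inner_le_norm _ _).trans ?_)
  rw [dist_eq_norm] at hy
  gcongr

theorem tendsto_moreau {ι : Type*} {l : Filter ι} {ψ : E → ℝ} (hψ : ConvexOn ℝ univ ψ)
    {lam : ι → ℝ} (hpos : ∀ k, 0 < lam k) (hlam : Tendsto lam l (𝓝 0)) {pk : ι → E} {p : E}
    (hp : Tendsto pk l (𝓝 p)) : Tendsto (fun k => moreau ψ (lam k) (pk k)) l (𝓝 (ψ p)) := by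
  obtain ⟨s, hs⟩ := subdiff_nonempty hψ p
  have h1 : Tendsto (fun k => ψ p + inner ℝ s (pk k - p) - lam k / 2 * ‖s‖ ^ 2) l
      (𝓝 (ψ p + inner ℝ s (p - p) - 0 / 2 * ‖s‖ ^ 2)) :=
    ((tendsto_const_nhds.add (tendsto_const_nhds.inner (hp.sub_const p)))).sub
      ((hlam.div_const 2).mul_const _)
  simp only [sub_self, inner_zero_right, zero_div, zero_mul, add_zero, sub_zero] at h1
  exact tendsto_of_tendsto_of_tendsto_of_le_of_le h1
    (((continuous_of_convexOn hψ).tendsto p).comp hp)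
    (fun k => le_moreau hs (hpos k) _) (fun k => moreau_le_self hψ (hpos k) _)

end ConvexAnalysis

/-! ### The supremum function and the conic constraint -/

section SupFun

variable {H : Type*} [NormedAddCommGroup H] [InnerProductSpace ℝ H]
variable {Y : Type*} [NormedAddCommGroup Y] [NormedSpace ℝ Y]
variable {m : ℕ}

theorem bddAbove_supFun {C : Set (WeakDual ℝ Y)} (hC : IsCompact C) (y : Y) (c : ℝ) :
    BddAbove ((fun w : WeakDual ℝ Y => w y + c) '' C) :=
  (hC.image ((WeakDual.eval_continuous y).add continuous_const)).bddAbove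

theorem convexOn_supFun {C : Set (WeakDual ℝ Y)} (hC_ne : C.Nonempty) (hC : IsCompact C)
    {Φ : H → Rm m → Y} {h : H → ℝ}
    (hΦ : ∀ w ∈ C, ConvexOn ℝ univ (fun p : H × Rm m => w (Φ p.1 p.2) + h p.1)) :
    ConvexOn ℝ univ (supFun C Φ h) := by
  refine ⟨convex_univ, fun p _ q _ a b ha hb hab => ?_⟩
  refine csSup_le (hC_ne.image _) ?_
  rintro _ ⟨w, hw, rfl⟩
  have h1 := (hΦ w hw).2 (mem_univ (p.fst, p.snd)) (mem_univ (q.fst, q.snd)) ha hb hab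
  refine h1.trans (add_le_add ?_ ?_)
  · exact mul_le_mul_of_nonneg_left (le_csSup (bddAbove_supFun hC _ _) ⟨w, hw, rfl⟩) ha
  · exact mul_le_mul_of_nonneg_left (le_csSup (bddAbove_supFun hC _ _) ⟨w, hw, rfl⟩) hb

/-- A point outside `K` is separated by an element of the polar cone, hence by a weak-star limit of
nonnegative multiples of elements of `C`. Evaluation at `Φ x z` is weak-star continuous, so its sign
on `C` decides. -/
theorem neg_mem_iff_supFun_le {C : Set (WeakDual ℝ Y)} (hC_ne : C.Nonempty) (hC : IsCompact C)
    {K : ProperCone ℝ Y} (hgen : GeneratesPolar C K) (Φ : H → Rm m → Y) (h : H → ℝ)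
    (x : H) (z : Rm m) : -(Φ x z) ∈ K ↔ supFun C Φ h (pt x z) ≤ h x := by
  have hsub : {w : WeakDual ℝ Y | ∃ t : ℝ, 0 ≤ t ∧ ∃ c ∈ C, w = t • c} ⊆
      {w : WeakDual ℝ Y | ∀ y ∈ K, 0 ≤ w y} := by
    rw [← hgen]; exact subset_closure
  constructor
  · intro hx
    refine csSup_le (hC_ne.image _) ?_
    rintro _ ⟨w, hw, rfl⟩
    have h1 : 0 ≤ w (-(Φ x z)) := hsub ⟨1, zero_le_one, w, hw, (one_smul _ _).symm⟩ _ hx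
    rw [map_neg] at h1
    change w (Φ x z) + h x ≤ h x
    linarith
  · intro hx
    by_contra hmem
    obtain ⟨g, hg, hneg⟩ := K.hyperplane_separation_point hmem
    have hle : ∀ w ∈ C, w (Φ x z) ≤ 0 := by
      intro w hw
      have : w (Φ x z) + h x ≤ supFun C Φ h (pt x z) :=
        le_csSup (bddAbove_supFun hC (Φ x z) (h x)) ⟨w, hw, rfl⟩
      linarith
    let g' : WeakDual ℝ Y := StrongDual.toWeakDual g
    have hg' : g' ∈ closure {w : WeakDual ℝ Y | ∃ t : ℝ, 0 ≤ t ∧ ∃ c ∈ C, w = t • c} := by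
      rw [show closure _ = _ from hgen]; exact hg
    have hclosed : IsClosed {w : WeakDual ℝ Y | w (Φ x z) ≤ 0} :=
      isClosed_le (WeakDual.eval_continuous _) continuous_const
    have : g' (Φ x z) ≤ 0 := by
      refine closure_minimal ?_ hclosed hg'
      rintro w ⟨t, ht, c, hc, rfl⟩
      exact mul_nonpos_of_nonneg_of_nonpos ht (hle c hc)
    rw [map_neg] at hneg
    have h2 : g (Φ x z) ≤ 0 := this
    linarith

end SupFun

/-! ### The inverse radius: Lipschitz continuity and derivative -/

section InverseRadius

variable {H : Type*} [NormedAddCommGroup H] [InnerProductSpace ℝ H] {m : ℕ}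

theorem smul_pt_add_smul_pt (a b : ℝ) (x y : H) (z w : Rm m) :
    a • pt x z + b • pt y w = pt (a • x + b • y) (a • z + b • w) := rfl

/-- The map `(x, z) ↦ pt x z` as a continuous linear map. -/
noncomputable def ptCLM (H : Type*) [NormedAddCommGroup H] [InnerProductSpace ℝ H] (m : ℕ) :
    H × Rm m →L[ℝ] WithLp 2 (H × Rm m) :=
  (WithLp.prodContinuousLinearEquiv 2 ℝ H (Rm m)).symm

theorem ptCLM_apply (q : H × Rm m) : ptCLM H m q = pt q.1 q.2 := rfl

theorem continuous_pt : Continuous fun q : H × Rm m => pt q.1 q.2 := (ptCLM H m).continuous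

/-- The inverse of the radial function: the infimum of the `t > 0` for which `(x, t⁻¹ a)` is
feasible. It vanishes in the directions in which the feasible set is unbounded. -/
noncomputable def invRadius (T : WithLp 2 (H × Rm m) → ℝ) (h : H → ℝ) (x : H) (a : Rm m) : ℝ :=
  sInf {t : ℝ | 0 < t ∧ T (pt x (t⁻¹ • a)) ≤ h x}

/-- Quantitative form of the Slater condition near `x₀`. -/
structure IsSlaterRadius (T : WithLp 2 (H × Rm m) → ℝ) (h : H → ℝ) (x₀ : H) (δ r₀ : ℝ) :
    Prop where
  pos : 0 < δ
  r_pos : 0 < r₀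
  slater : ∀ x ∈ Metric.ball x₀ δ, T (pt x 0) < h x
  feasible_ball : ∀ x ∈ Metric.ball x₀ δ, ∀ z : Rm m, ‖z‖ ≤ r₀ → T (pt x z) ≤ h x
  shrink : ∀ x ∈ Metric.ball x₀ δ, ∀ y ∈ Metric.ball x₀ δ, ∀ z : Rm m, T (pt x z) ≤ h x →
    T (pt y ((1 - ‖y - x‖ / (2 * δ)) • z)) ≤ h y

/-- The constants are chosen for `S` before `T` is given, which makes all later estimates uniform
over convex minorants. For `shrink`, `y` is a convex combination of `x` and a further point `w` on
the ray from `x` through `y`; the Slater margin at `w` pays for the variation of `h`. -/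
theorem exists_isSlaterRadius {S : WithLp 2 (H × Rm m) → ℝ} (hS : Continuous S) {h : H → ℝ}
    (hh : ContDiff ℝ 1 h) {x₀ : H} (hsl : S (pt x₀ 0) < h x₀) :
    ∃ δ r₀ : ℝ, 0 < δ ∧ ∀ T : WithLp 2 (H × Rm m) → ℝ, ConvexOn ℝ univ T → (∀ p, T p ≤ S p) →
      IsSlaterRadius T h x₀ δ r₀ := by
  obtain ⟨c, hc, hcS⟩ : ∃ c : ℝ, 0 < c ∧ S (pt x₀ 0) < h x₀ - c :=
    ⟨(h x₀ - S (pt x₀ 0)) / 2, by linarith, by linarith⟩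
  obtain ⟨ℓ, U, hU, hℓ⟩ := hh.contDiffAt.exists_lipschitzOnWith (x := x₀)
  have hSq : ∀ᶠ q : H × Rm m in 𝓝 (x₀, 0), S (pt q.1 q.2) < h x₀ - c :=
    (hS.comp continuous_pt).continuousAt.eventually_lt continuousAt_const hcS
  obtain ⟨d₁, hd₁, hd₁S⟩ := Metric.eventually_nhds_iff_ball.1 hSq
  have hhx : ∀ᶠ x in 𝓝 x₀, |h x - h x₀| < c / 2 := by
    have := Metric.tendsto_nhds.1 (hh.continuous.tendsto x₀) (c / 2) (by positivity)
    simpa [Real.dist_eq] using this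
  obtain ⟨d₂, hd₂, hd₂h⟩ := Metric.eventually_nhds_iff_ball.1 (hhx.and hU)
  -- The point `w` below lies within `3 * δ` of `x₀`. From `x` to `y` the function `h` drops by at
  -- most `α * (ℓ * (2 * δ))`, which the margin `α * (c / 2)` must cover.
  obtain ⟨δ, hδ, h1, h2, h3⟩ : ∃ δ : ℝ, 0 < δ ∧ 3 * δ ≤ d₁ ∧ δ ≤ d₂ ∧ ℓ * (2 * δ) ≤ c / 2 := by
    refine ⟨min (min (d₁ / 3) d₂) (c / (4 * (ℓ + 1))), by positivity, ?_, ?_, ?_⟩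
    · have := (min_le_left (min (d₁ / 3) d₂) (c / (4 * ((ℓ : ℝ) + 1)))).trans (min_le_left _ _)
      linarith
    · exact (min_le_left _ _).trans (min_le_right _ _)
    · have := min_le_right (min (d₁ / 3) d₂) (c / (4 * ((ℓ : ℝ) + 1)))
      rw [le_div_iff₀ (by positivity)] at this
      have h0 : 0 < min (min (d₁ / 3) d₂) (c / (4 * ((ℓ : ℝ) + 1))) := by positivity
      nlinarith
  have hval : ∀ w ∈ Metric.ball x₀ (3 * δ), ∀ z : Rm m, ‖z‖ ≤ d₁ / 2 →
      S (pt w z) < h x₀ - c := by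
    intro w hw z hz
    refine hd₁S (w, z) ?_
    rw [← ball_prod_same]
    refine ⟨Metric.ball_subset_ball h1 hw, ?_⟩
    rw [mem_ball_zero_iff]
    linarith
  have hball : Metric.ball x₀ δ ⊆ Metric.ball x₀ (3 * δ) :=
    Metric.ball_subset_ball (by linarith)
  have hhb : ∀ x ∈ Metric.ball x₀ δ, |h x - h x₀| < c / 2 ∧ x ∈ U := fun x hx =>
    ⟨(hd₂h x (Metric.ball_subset_ball h2 hx)).1, (hd₂h x (Metric.ball_subset_ball h2 hx)).2⟩
  refine ⟨δ, d₁ / 2, hδ, fun T hT hTS => ⟨hδ, by positivity, ?_, ?_, ?_⟩⟩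
  · intro x hx
    have := hval x (hball hx) 0 (by simp; positivity)
    have := (abs_lt.1 (hhb x hx).1).1
    linarith [hTS (pt x 0)]
  · intro x hx z hz
    have := hval x (hball hx) z hz
    have := (abs_lt.1 (hhb x hx).1).1
    linarith [hTS (pt x z)]
  · intro x hx y hy z hz
    rcases eq_or_ne y x with rfl | hne
    · simpa using hz
    have hn : 0 < ‖y - x‖ := norm_pos_iff.2 (sub_ne_zero.2 hne)
    set α := ‖y - x‖ / (2 * δ) with hα
    have hα0 : 0 < α := by positivity
    have hα1 : α ≤ 1 := by
      rw [hα, div_le_one (by positivity)]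
      rw [mem_ball_iff_norm] at hx hy
      have : y - x = (y - x₀) - (x - x₀) := by abel
      rw [this]
      exact (norm_sub_le _ _).trans (by linarith)
    -- This is the point at distance exactly `2 * δ` from `x` in the direction of `y`.
    set w := x + α⁻¹ • (y - x) with hw
    have hwx : ‖w - x₀‖ < 3 * δ := by
      rw [mem_ball_iff_norm] at hx
      have h4 : w - x₀ = (x - x₀) + α⁻¹ • (y - x) := by rw [hw]; abel
      have h5 : ‖α⁻¹ • (y - x)‖ = 2 * δ := by
        rw [norm_smul, norm_inv, Real.norm_of_nonneg hα0.le, hα]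
        field_simp
      rw [h4]
      refine (norm_add_le _ _).trans_lt ?_
      rw [h5]; linarith
    have hTw := hval w (mem_ball_iff_norm.2 hwx) 0 (by simp; positivity)
    have hcomb := hT.2 (mem_univ (pt x z)) (mem_univ (pt w 0)) (sub_nonneg.2 hα1) hα0.le
      (by ring)
    have h6 : (1 - α) • x + α • w = y := by
      rw [hw, smul_add, smul_inv_smul₀ hα0.ne']; module
    rw [smul_pt_add_smul_pt, h6, smul_zero, add_zero, smul_eq_mul, smul_eq_mul] at hcomb
    have hlip := hℓ.dist_le_mul x (hhb x hx).2 y (hhb y hy).2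
    rw [Real.dist_eq, dist_eq_norm, norm_sub_rev x y] at hlip
    have h7 : ‖y - x‖ = α * (2 * δ) := by rw [hα]; field_simp
    rw [h7] at hlip
    have h8 := (abs_le.1 hlip).2
    have h9 := (abs_lt.1 (hhb x hx).1).1
    have h10 : (1 - α) * T (pt x z) ≤ (1 - α) * h x :=
      mul_le_mul_of_nonneg_left hz (sub_nonneg.2 hα1)
    have h11 : α * T (pt w 0) ≤ α * (h x - c / 2) :=
      mul_le_mul_of_nonneg_left (by linarith [hTS (pt w 0)]) hα0.le
    have h12 : α * (ℓ * (2 * δ)) ≤ α * (c / 2) := mul_le_mul_of_nonneg_left h3 hα0.le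
    nlinarith

variable {T : WithLp 2 (H × Rm m) → ℝ} {h : H → ℝ} {x₀ : H} {δ r₀ : ℝ}

theorem invRadius_nonneg (x : H) (a : Rm m) : 0 ≤ invRadius T h x a :=
  Real.sInf_nonneg fun _ ht => ht.1.le

theorem bddBelow_invRadius (x : H) (a : Rm m) :
    BddBelow {t : ℝ | 0 < t ∧ T (pt x (t⁻¹ • a)) ≤ h x} := ⟨0, fun _ ht => ht.1.le⟩

theorem feasible_of_le (hT : ConvexOn ℝ univ T) {x : H} (hsl : T (pt x 0) ≤ h x) {a : Rm m}
    {s t : ℝ} (hs : 0 < s) (hst : s ≤ t) (hf : T (pt x (s⁻¹ • a)) ≤ h x) :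
    T (pt x (t⁻¹ • a)) ≤ h x := by
  have ht : 0 < t := hs.trans_le hst
  have h1 : s / t ≤ 1 := (div_le_one ht).2 hst
  have h0 : 0 ≤ s / t := by positivity
  have hc := hT.2 (mem_univ (pt x (s⁻¹ • a))) (mem_univ (pt x 0)) h0 (sub_nonneg.2 h1) (by ring)
  have h2 : (s / t) • x + (1 - s / t) • x = x := by module
  have h3 : (s / t) • s⁻¹ • a = t⁻¹ • a := by
    rw [smul_smul]; congr 1; field_simp
  rw [smul_pt_add_smul_pt, h2, h3, smul_zero, add_zero, smul_eq_mul, smul_eq_mul] at hc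
  have := mul_le_mul_of_nonneg_left hf h0
  have := mul_le_mul_of_nonneg_left hsl (sub_nonneg.2 h1)
  nlinarith

namespace IsSlaterRadius

theorem invRadius_le (hR : IsSlaterRadius T h x₀ δ r₀) {x : H} (hx : x ∈ Metric.ball x₀ δ)
    {a : Rm m} (ha : a ≠ 0) : invRadius T h x a ≤ ‖a‖ / r₀ := by
  have hr := hR.r_pos
  have hn : 0 < ‖a‖ := norm_pos_iff.2 ha
  refine csInf_le (bddBelow_invRadius x a) ⟨by positivity, hR.feasible_ball x hx _ ?_⟩
  rw [norm_smul, norm_inv, Real.norm_of_nonneg (by positivity)]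
  field_simp
  exact le_rfl

theorem nonempty_feasible (hR : IsSlaterRadius T h x₀ δ r₀) {x : H} (hx : x ∈ Metric.ball x₀ δ)
    {a : Rm m} (ha : a ≠ 0) : {t : ℝ | 0 < t ∧ T (pt x (t⁻¹ • a)) ≤ h x}.Nonempty := by
  have hr := hR.r_pos
  have hn : 0 < ‖a‖ := norm_pos_iff.2 ha
  refine ⟨‖a‖ / r₀, by positivity, hR.feasible_ball x hx _ ?_⟩
  rw [norm_smul, norm_inv, Real.norm_of_nonneg (by positivity)]
  field_simp
  exact le_rfl

/-- The feasible parameters form an up-set, by convexity with the Slater point, which is closed in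
`(0, ∞)` by continuity of `T`. -/
theorem invRadius_le_iff (hR : IsSlaterRadius T h x₀ δ r₀) (hT : ConvexOn ℝ univ T)
    (hTc : Continuous T) {x : H} (hx : x ∈ Metric.ball x₀ δ) {a : Rm m} (ha : a ≠ 0) {t : ℝ}
    (ht : 0 < t) : invRadius T h x a ≤ t ↔ T (pt x (t⁻¹ • a)) ≤ h x := by
  refine ⟨fun hle => ?_, fun hf => csInf_le (bddBelow_invRadius x a) ⟨ht, hf⟩⟩
  have hgt : ∀ s, t < s → T (pt x (s⁻¹ • a)) ≤ h x := by
    intro s hs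
    obtain ⟨r, hr, hrs⟩ := exists_lt_of_csInf_lt (hR.nonempty_feasible hx ha) (hle.trans_lt hs)
    exact feasible_of_le hT (hR.slater x hx).le hr.1 hrs.le hr.2
  have hcont : ContinuousAt (fun s : ℝ => T (pt x (s⁻¹ • a))) t := by
    refine (hTc.comp continuous_pt).continuousAt.comp (f := fun s : ℝ => (x, s⁻¹ • a)) ?_
    exact continuousAt_const.prodMk ((continuousAt_inv₀ ht.ne').smul continuousAt_const)
  refine le_of_tendsto (hcont.tendsto.mono_left (nhdsWithin_le_nhds (s := Ioi t))) ?_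
  filter_upwards [self_mem_nhdsWithin] with s hs using hgt s hs

theorem eq_of_invRadius_pos (hR : IsSlaterRadius T h x₀ δ r₀) (hT : ConvexOn ℝ univ T)
    (hTc : Continuous T) {x : H} (hx : x ∈ Metric.ball x₀ δ) {a : Rm m} (ha : a ≠ 0)
    (ht : 0 < invRadius T h x a) : T (pt x ((invRadius T h x a)⁻¹ • a)) = h x := by
  refine le_antisymm ((hR.invRadius_le_iff hT hTc hx ha ht).1 le_rfl) ?_
  set t := invRadius T h x a
  have hcont : ContinuousAt (fun s : ℝ => T (pt x (s⁻¹ • a))) t := by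
    refine (hTc.comp continuous_pt).continuousAt.comp (f := fun s : ℝ => (x, s⁻¹ • a)) ?_
    exact continuousAt_const.prodMk ((continuousAt_inv₀ ht.ne').smul continuousAt_const)
  refine ge_of_tendsto (hcont.tendsto.mono_left (nhdsWithin_le_nhds (s := Iio t))) ?_
  filter_upwards [self_mem_nhdsWithin, nhdsWithin_le_nhds (lt_mem_nhds ht)] with s hs hs0
  by_contra! hlt
  exact absurd ((hR.invRadius_le_iff hT hTc hx ha hs0).2 hlt.le) (not_le.2 hs)

/-- Shrinking a feasible point by the factor `β` keeps it feasible after moving from `x` to `y`; in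
inverse radii this divides `t` by `β`. -/
theorem mul_invRadius_le (hR : IsSlaterRadius T h x₀ δ r₀) (hT : ConvexOn ℝ univ T)
    (hTc : Continuous T) {x y : H} (hx : x ∈ Metric.ball x₀ δ) (hy : y ∈ Metric.ball x₀ δ)
    {a : Rm m} (ha : a ≠ 0) :
    (1 - ‖y - x‖ / (2 * δ)) * invRadius T h y a ≤ invRadius T h x a := by
  have hδ := hR.pos
  have hα : ‖y - x‖ / (2 * δ) < 1 := by
    rw [div_lt_one (by positivity)]
    rw [mem_ball_iff_norm] at hx hy
    have : y - x = (y - x₀) - (x - x₀) := by abel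
    rw [this]
    exact (norm_sub_le _ _).trans_lt (by linarith)
  set β := 1 - ‖y - x‖ / (2 * δ) with hβ
  have hβ0 : 0 < β := by linarith
  refine le_of_forall_gt_imp_ge_of_dense fun t ht => ?_
  have ht0 : 0 < t := (invRadius_nonneg x a).trans_lt ht
  have h1 := hR.shrink x hx y hy _ ((hR.invRadius_le_iff hT hTc hx ha ht0).1 ht.le)
  have h2 : β • t⁻¹ • a = (t / β)⁻¹ • a := by rw [smul_smul, inv_div, div_eq_mul_inv]
  rw [← hβ, h2] at h1
  have h3 := (hR.invRadius_le_iff hT hTc hy ha (by positivity : 0 < t / β)).2 h1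
  rw [le_div_iff₀ hβ0] at h3
  linarith

/-- The inverse radius is Lipschitz in `x`, also in unbounded directions. Together with the decay
of the density of order `m + 1` this bounds the gradients of the probability functions without
recourse to a growth condition. -/
theorem abs_invRadius_sub_le (hR : IsSlaterRadius T h x₀ δ r₀) (hT : ConvexOn ℝ univ T)
    (hTc : Continuous T) {x y : H} (hx : x ∈ Metric.ball x₀ δ) (hy : y ∈ Metric.ball x₀ δ)
    {a : Rm m} (ha : a ≠ 0) :
    |invRadius T h y a - invRadius T h x a| ≤ ‖a‖ / (2 * δ * r₀) * ‖y - x‖ := by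
  have hδ := hR.pos
  have hr := hR.r_pos
  have key : ∀ x ∈ Metric.ball x₀ δ, ∀ y ∈ Metric.ball x₀ δ,
      invRadius T h y a - invRadius T h x a ≤ ‖a‖ / (2 * δ * r₀) * ‖y - x‖ := by
    intro x hx y hy
    have h1 := hR.mul_invRadius_le hT hTc hx hy ha
    have h2 := mul_le_mul_of_nonneg_left (hR.invRadius_le hy ha)
      (by positivity : 0 ≤ ‖y - x‖ / (2 * δ))
    have h3 : ‖y - x‖ / (2 * δ) * (‖a‖ / r₀) = ‖a‖ / (2 * δ * r₀) * ‖y - x‖ := by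
      field_simp
    linarith
  refine abs_le.2 ⟨?_, key x hx y hy⟩
  have := key y hy x hx
  rw [norm_sub_rev] at this
  linarith

end IsSlaterRadius

theorem invRadius_mono {S : WithLp 2 (H × Rm m) → ℝ} (hTS : ∀ p, T p ≤ S p)
    (hR : IsSlaterRadius S h x₀ δ r₀) {x : H} (hx : x ∈ Metric.ball x₀ δ) {a : Rm m}
    (ha : a ≠ 0) : invRadius T h x a ≤ invRadius S h x a :=
  csInf_le_csInf (bddBelow_invRadius x a) (hR.nonempty_feasible hx ha)
    fun _ ht => ⟨ht.1, (hTS _).trans ht.2⟩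

/-- The derivative of the inverse radius at a point with subgradient `s`, value `t` and derivative
`h'` of the right-hand side. -/
noncomputable def invRadiusDeriv (s : WithLp 2 (H × Rm m)) (a : Rm m) (t : ℝ) (h' : H →L[ℝ] ℝ) :
    H →L[ℝ] ℝ :=
  (t ^ 2 / inner ℝ s.snd a) • (innerSL ℝ s.fst - h')

/-- The subgradient inequality tested at the Slater point `(x, 0)`: the ray crosses the boundary
transversally, so implicit differentiation never divides by zero. -/
theorem inner_snd_pos {s : WithLp 2 (H × Rm m)} {x : H} {a : Rm m} {t : ℝ} (ht : 0 < t)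
    (hs : s ∈ subdiff T (pt x (t⁻¹ • a))) (hsl : T (pt x 0) < T (pt x (t⁻¹ • a))) :
    0 < inner ℝ s.snd a := by
  have h1 := hs (pt x 0)
  have h2 : inner ℝ s (pt x 0 - pt x (t⁻¹ • a)) = -(t⁻¹ * inner ℝ s.snd a) := by
    rw [WithLp.prod_inner_apply]
    change inner ℝ s.fst (x - x) + inner ℝ s.snd (0 - t⁻¹ • a) = _
    rw [sub_self, inner_zero_right, zero_sub, inner_neg_right, real_inner_smul_right, zero_add]
  rw [h2] at h1
  have h3 : 0 < t⁻¹ * inner ℝ s.snd a := by linarith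
  exact (mul_pos_iff_of_pos_left (inv_pos.2 ht)).1 h3

/-- Implicit differentiation of `T(y, τ(y)⁻¹ a) = h(y)`. Since `T` is differentiable only at one
point, the Lipschitz bound on `τ` takes the place of the implicit function theorem. -/
theorem IsSlaterRadius.hasFDerivAt_invRadius (hR : IsSlaterRadius T h x₀ δ r₀)
    (hT : ConvexOn ℝ univ T) (hTc : Continuous T) {x : H} (hx : x ∈ Metric.ball x₀ δ) {a : Rm m}
    (ha : a ≠ 0) (ht : 0 < invRadius T h x a) {s : WithLp 2 (H × Rm m)}
    (hs : s ∈ subdiff T (pt x ((invRadius T h x a)⁻¹ • a)))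
    (hTd : HasFDerivAt T (innerSL ℝ s) (pt x ((invRadius T h x a)⁻¹ • a)))
    {h' : H →L[ℝ] ℝ} (hh : HasFDerivAt h h' x) :
    HasFDerivAt (fun y => invRadius T h y a) (invRadiusDeriv s a (invRadius T h x a) h') x := by
  set τ : H → ℝ := fun y => invRadius T h y a with hτ
  change 0 < τ x at ht
  have hβ : 0 < inner ℝ s.snd a :=
    inner_snd_pos ht hs (by
      rw [hR.eq_of_invRadius_pos hT hTc hx ha ht]; exact hR.slater x hx)
  have hball : Metric.ball x₀ δ ∈ 𝓝 x := Metric.isOpen_ball.mem_nhds hx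
  have hO : (fun y => τ y - τ x) =O[𝓝 x] fun y => y - x := by
    refine Asymptotics.IsBigO.of_bound (‖a‖ / (2 * δ * r₀)) ?_
    filter_upwards [hball] with y hy
    exact hR.abs_invRadius_sub_le hT hTc hx hy ha
  have hτc : Tendsto τ (𝓝 x) (𝓝 (τ x)) := by
    rw [tendsto_iff_norm_sub_tendsto_zero]
    refine (hO.trans_tendsto ?_).norm.trans (by simp)
    exact tendsto_sub_nhds_zero_iff.2 tendsto_id
  have hinner : HasFDerivAt (fun q : H × ℝ => (q.1, q.2⁻¹ • a))
      ((ContinuousLinearMap.fst ℝ H ℝ).prod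
        ((-((τ x) ^ 2)⁻¹ • ContinuousLinearMap.snd ℝ H ℝ).smulRight a)) (x, τ x) := by
    refine hasFDerivAt_fst.prodMk ?_
    have h1 : HasFDerivAt (fun q : H × ℝ => q.2⁻¹)
        (-((τ x) ^ 2)⁻¹ • ContinuousLinearMap.snd ℝ H ℝ) (x, τ x) :=
      (hasDerivAt_inv ht.ne').comp_hasFDerivAt (x, τ x) hasFDerivAt_snd
    exact h1.smul_const a
  have hG : HasFDerivAt (fun q : H × ℝ => T (ptCLM H m (q.1, q.2⁻¹ • a)) - h q.1)
      ((innerSL ℝ s).comp ((ptCLM H m).comp ((ContinuousLinearMap.fst ℝ H ℝ).prod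
        ((-((τ x) ^ 2)⁻¹ • ContinuousLinearMap.snd ℝ H ℝ).smulRight a)))
        - h'.comp (ContinuousLinearMap.fst ℝ H ℝ)) (x, τ x) := by
    refine HasFDerivAt.sub ?_ (HasFDerivAt.comp (x, τ x) (g := h) hh hasFDerivAt_fst)
    refine HasFDerivAt.comp (x, τ x) (g := T) hTd ?_
    exact (ptCLM H m).hasFDerivAt.comp (x, τ x) hinner
  have hγ : Tendsto (fun y => (y, τ y)) (𝓝 x) (𝓝 (x, τ x)) := tendsto_id.prodMk_nhds hτc
  -- Along the curve `(y, τ y)` the error is `o(y - x)` because `τ y - τ x` is `O(y - x)`; as the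
  -- equation holds on the curve, the linear part alone is `o(y - x)`.
  have hlo := (hG.isLittleO.comp_tendsto hγ).trans_isBigO
    ((Asymptotics.isBigO_refl (fun y => y - x) (𝓝 x)).prod_left hO)
  rw [hasFDerivAt_iff_isLittleO]
  refine ((hlo.const_mul_left (τ x ^ 2 / inner ℝ s.snd a))).congr' ?_ EventuallyEq.rfl
  filter_upwards [hball, hτc.eventually (lt_mem_nhds ht)] with y hy hy0
  have e1 : T (pt y ((τ y)⁻¹ • a)) = h y := hR.eq_of_invRadius_pos hT hTc hy ha hy0
  have e2 : T (pt x ((τ x)⁻¹ • a)) = h x := hR.eq_of_invRadius_pos hT hTc hx ha ht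
  simp only [Function.comp_apply, ptCLM_apply, e1, e2, sub_self, zero_sub,
    _root_.sub_apply, ContinuousLinearMap.comp_apply, innerSL_apply_apply,
    ContinuousLinearMap.prod_apply, ContinuousLinearMap.smulRight_apply, Prod.mk_sub_mk,
    ContinuousLinearMap.coe_fst', _root_.smul_apply, ContinuousLinearMap.coe_snd',
    invRadiusDeriv, WithLp.prod_inner_apply]
  change _ * -(inner ℝ s.fst (y - x) + inner ℝ s.snd ((-((τ x) ^ 2)⁻¹ • (τ y - τ x)) • a)
    - h' (y - x)) = τ y - τ x - τ x ^ 2 / inner ℝ s.snd a *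
      (inner ℝ s.fst (y - x) - h' (y - x))
  rw [real_inner_smul_right, smul_eq_mul]
  field_simp
  ring

end InverseRadius

/-! ### The radial density in the variable `u = 1 / r` -/

section RadialDensity

variable {m : ℕ}

/-- The density, in the inverse radius `u = 1 / r`, of the mass carried by the ray of `a`. -/
noncomputable def radialDensity (f : Rm m → ℝ) (a : Rm m) (u : ℝ) : ℝ :=
  ‖a‖⁻¹ ^ (m + 1) * (‖u⁻¹ • a‖ ^ (m + 1) * f (u⁻¹ • a))

/-- The convention `0⁻¹ = 0` makes the value at `u = 0` vanish, which is also the limit imposed by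
the tail of `f`. -/
theorem radialDensity_zero (f : Rm m → ℝ) (a : Rm m) : radialDensity f a 0 = 0 := by
  simp [radialDensity]

theorem radialDensity_of_pos (f : Rm m → ℝ) {a : Rm m} (ha : a ≠ 0) {u : ℝ} (hu : 0 < u) :
    radialDensity f a u = u⁻¹ ^ (m + 1) * f (u⁻¹ • a) := by
  have hn : ‖a‖ ≠ 0 := norm_ne_zero_iff.2 ha
  rw [radialDensity, norm_smul, norm_inv, Real.norm_of_nonneg hu.le, ← mul_assoc, ← mul_pow]
  congr 2
  field_simp

theorem continuous_radialDensity {f : Rm m → ℝ} (hf : Continuous f)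
    (htail : Tendsto (fun z => ‖z‖ ^ (m + 1) * f z) (Bornology.cobounded (Rm m)) (𝓝 0))
    {a : Rm m} (ha : a ≠ 0) : Continuous (radialDensity f a) := by
  refine continuous_const.mul (continuous_iff_continuousAt.2 fun u => ?_)
  have hq : Continuous fun z : Rm m => ‖z‖ ^ (m + 1) * f z := by fun_prop
  rcases eq_or_ne u 0 with rfl | hu
  · have hinv : Tendsto (fun u : ℝ => u⁻¹ • a) (𝓝[≠] 0) (Bornology.cobounded (Rm m)) := by
      rw [← tendsto_norm_atTop_iff_cobounded]
      simp only [norm_smul]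
      exact tendsto_norm_inv_nhdsNE_zero_atTop.atTop_mul_const (norm_pos_iff.2 ha)
    rw [continuousAt_iff_punctured_nhds]
    simpa [Function.comp_def] using htail.comp hinv
  · exact hq.continuousAt.comp (f := fun u : ℝ => u⁻¹ • a)
      ((continuousAt_inv₀ hu).smul continuousAt_const)

theorem exists_bound_of_tendsto_cobounded {E : Type*} [NormedAddCommGroup E] [ProperSpace E]
    {q : E → ℝ} (hq : Continuous q) (hlim : Tendsto q (Bornology.cobounded E) (𝓝 0)) :
    ∃ B, 0 ≤ B ∧ ∀ z, |q z| ≤ B := by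
  have h1 : ∀ᶠ z in Bornology.cobounded E, |q z| < 1 := by
    simpa [Real.dist_eq] using Metric.tendsto_nhds.1 hlim 1 one_pos
  obtain ⟨R, -, hR⟩ := (hasBasis_cobounded_norm (E := E)).eventually_iff.1 h1
  obtain ⟨M, hM⟩ := (isCompact_closedBall (0 : E) R).exists_bound_of_continuousOn hq.continuousOn
  refine ⟨max 1 M, by positivity, fun z => ?_⟩
  rcases le_total ‖z‖ R with hz | hz
  · exact (hM z (by simpa using hz)).trans (le_max_right _ _)
  · exact (hR hz).le.trans (le_max_left _ _)

theorem abs_radialDensity_le {f : Rm m → ℝ} {B : ℝ} (hB : ∀ z : Rm m, |‖z‖ ^ (m + 1) * f z| ≤ B)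
    (a : Rm m) (u : ℝ) : |radialDensity f a u| ≤ ‖a‖⁻¹ ^ (m + 1) * B := by
  rw [radialDensity, abs_mul, abs_of_nonneg (by positivity)]
  gcongr
  exact hB _

/-- Near `0` continuity suffices; for `u > 1` the argument of `f` stays in a ball and `u⁻¹ ^ (m + 1)
≤ u⁻¹ ^ 2`, since `m ≥ 1`. -/
theorem integrableOn_radialDensity (hm : 0 < m) {f : Rm m → ℝ} (hf : Continuous f)
    (htail : Tendsto (fun z => ‖z‖ ^ (m + 1) * f z) (Bornology.cobounded (Rm m)) (𝓝 0))
    {a : Rm m} (ha : a ≠ 0) : IntegrableOn (radialDensity f a) (Ioi 0) := by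
  have hc := continuous_radialDensity hf htail ha
  rw [← Ioc_union_Ioi_eq_Ioi zero_le_one]
  refine IntegrableOn.union ((hc.integrableOn_Icc (a := 0) (b := 1)).mono_set Ioc_subset_Icc_self) ?_
  obtain ⟨M, hM⟩ := (isCompact_closedBall (0 : Rm m) ‖a‖).exists_bound_of_continuousOn
    hf.continuousOn
  have hpow : IntegrableOn (fun u : ℝ => M * u ^ (-2 : ℝ)) (Ioi 1) :=
    (integrableOn_Ioi_rpow_of_lt (by norm_num) one_pos).const_mul M
  refine hpow.mono' hc.aestronglyMeasurable ?_
  refine (ae_restrict_iff' measurableSet_Ioi).2 (Eventually.of_forall fun u hu => ?_)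
  have hu1 : (1 : ℝ) < u := hu
  have hu0 : (0 : ℝ) < u := one_pos.trans hu1
  have hinv : u⁻¹ ≤ 1 := inv_le_one_of_one_le₀ hu1.le
  rw [radialDensity_of_pos f ha hu0, norm_mul, norm_pow, norm_inv, Real.norm_of_nonneg hu0.le]
  have h1 : ‖f (u⁻¹ • a)‖ ≤ M := by
    refine hM _ ?_
    rw [mem_closedBall_zero_iff, norm_smul, norm_inv, Real.norm_of_nonneg hu0.le]
    exact mul_le_of_le_one_left (norm_nonneg _) hinv
  have h2 : u⁻¹ ^ (m + 1) ≤ u⁻¹ ^ 2 := pow_le_pow_of_le_one (by positivity) hinv (by omega)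
  have h3 : u ^ (-2 : ℝ) = u⁻¹ ^ 2 := by
    rw [Real.rpow_neg hu0.le, inv_pow]; norm_num
  rw [h3, mul_comm M]
  exact mul_le_mul h2 h1 (norm_nonneg _) (by positivity)

end RadialDensity

/-! ### The mass carried by one ray, its derivative and its limits -/

section RadialMass

variable {H : Type*} [NormedAddCommGroup H] [InnerProductSpace ℝ H] {m : ℕ}

/-- The mass of the feasible set at `x` carried by the ray of `a`. -/
noncomputable def radialMass (T : WithLp 2 (H × Rm m) → ℝ) (h : H → ℝ) (f : Rm m → ℝ) (x : H)
    (a : Rm m) : ℝ :=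
  ∫ r in Ioi (0 : ℝ), r ^ (m - 1) * {z | T (pt x z) ≤ h x}.indicator f (r • a)

variable {T : WithLp 2 (H × Rm m) → ℝ} {h : H → ℝ} {f : Rm m → ℝ} {x₀ : H} {δ r₀ : ℝ}

/-- The substitution `r = 1 / u` turns `r ^ (m - 1) dr` into `u⁻¹ ^ (m + 1) du`, and the feasible
segment into `u ≥ τ`. -/
theorem IsSlaterRadius.radialMass_eq (hR : IsSlaterRadius T h x₀ δ r₀) (hm : 0 < m)
    (hf : Continuous f)
    (htail : Tendsto (fun z => ‖z‖ ^ (m + 1) * f z) (Bornology.cobounded (Rm m)) (𝓝 0))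
    (hT : ConvexOn ℝ univ T) (hTc : Continuous T) {x : H} (hx : x ∈ Metric.ball x₀ δ) {a : Rm m}
    (ha : a ≠ 0) :
    radialMass T h f x a = (∫ u in Ioi (0 : ℝ), radialDensity f a u) -
      ∫ u in (0 : ℝ)..invRadius T h x a, radialDensity f a u := by
  set τ := invRadius T h x a with hτ
  have hτ0 : 0 ≤ τ := invRadius_nonneg x a
  have hint := integrableOn_radialDensity hm hf htail ha
  rw [← intervalIntegral.integral_Ioi_sub_Ioi hint hτ0, sub_sub_cancel, radialMass,
    ← integral_comp_rpow_Ioi _ (by norm_num : (-1 : ℝ) ≠ 0)]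
  have hcongr : ∀ u ∈ Ioi (0 : ℝ), (|(-1 : ℝ)| * u ^ ((-1 : ℝ) - 1)) •
      ((u ^ (-1 : ℝ)) ^ (m - 1) * {z | T (pt x z) ≤ h x}.indicator f (u ^ (-1 : ℝ) • a))
      = (Ici τ).indicator (radialDensity f a) u := by
    intro u hu
    have hu0 : (0 : ℝ) < u := hu
    have h1 : u ^ ((-1 : ℝ) - 1) = u⁻¹ ^ 2 := by
      rw [show ((-1 : ℝ) - 1) = -2 by norm_num, Real.rpow_neg hu0.le, inv_pow]; norm_num
    rw [h1, Real.rpow_neg_one, abs_neg, abs_one, one_mul, smul_eq_mul]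
    have hiff := hR.invRadius_le_iff hT hTc hx ha hu0
    by_cases hle : τ ≤ u
    · rw [indicator_of_mem (show u ∈ Ici τ from hle),
        indicator_of_mem (show u⁻¹ • a ∈ {z | T (pt x z) ≤ h x} from hiff.1 hle),
        radialDensity_of_pos f ha hu0, ← mul_assoc, ← pow_add]
      congr 2
      -- `2 + (m - 1) = m + 1` with truncated subtraction needs `m ≥ 1`.
      omega
    · rw [indicator_of_notMem (show u ∉ Ici τ from hle),
        indicator_of_notMem (show u⁻¹ • a ∉ {z | T (pt x z) ≤ h x} from fun hc => hle (hiff.2 hc))]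
      simp
  rw [setIntegral_congr_fun measurableSet_Ioi hcongr, setIntegral_indicator measurableSet_Ici]
  rcases hτ0.eq_or_lt with h0 | h0
  · rw [← h0, inter_eq_left.2 Ioi_subset_Ici_self]
  · rw [inter_eq_right.2 (Ici_subset_Ioi.2 h0), integral_Ici_eq_integral_Ioi]

theorem IsSlaterRadius.abs_radialMass_sub_le (hR : IsSlaterRadius T h x₀ δ r₀) (hm : 0 < m)
    (hf : Continuous f)
    (htail : Tendsto (fun z => ‖z‖ ^ (m + 1) * f z) (Bornology.cobounded (Rm m)) (𝓝 0))
    {B : ℝ} (hB : ∀ z : Rm m, |‖z‖ ^ (m + 1) * f z| ≤ B)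
    (hT : ConvexOn ℝ univ T) (hTc : Continuous T) {x y : H} (hx : x ∈ Metric.ball x₀ δ)
    (hy : y ∈ Metric.ball x₀ δ) {a : Rm m} (ha : a ≠ 0) :
    |radialMass T h f y a - radialMass T h f x a| ≤
      ‖a‖⁻¹ ^ (m + 1) * B * (‖a‖ / (2 * δ * r₀)) * ‖y - x‖ := by
  have hc := continuous_radialDensity hf htail ha
  rw [hR.radialMass_eq hm hf htail hT hTc hx ha, hR.radialMass_eq hm hf htail hT hTc hy ha,
    sub_sub_sub_cancel_left, intervalIntegral.integral_interval_sub_left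
      (hc.intervalIntegrable _ _) (hc.intervalIntegrable _ _)]
  have hB0 : 0 ≤ B := (abs_nonneg _).trans (hB 0)
  refine (intervalIntegral.norm_integral_le_of_norm_le_const
    (f := radialDensity f a) (C := ‖a‖⁻¹ ^ (m + 1) * B) (fun u _ => abs_radialDensity_le hB a u)).trans ?_
  rw [mul_assoc (_ * B)]
  rw [abs_sub_comm]
  gcongr
  exact hR.abs_invRadius_sub_le hT hTc hx hy ha

variable [FiniteDimensional ℝ H]

/-- The gradient, as a linear form, of the mass carried by the ray of `a`. -/
noncomputable def radialMassDeriv (T : WithLp 2 (H × Rm m) → ℝ) (h : H → ℝ) (f : Rm m → ℝ) (x : H)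
    (a : Rm m) : H →L[ℝ] ℝ :=
  (-radialDensity f a (invRadius T h x a)) •
    invRadiusDeriv (gradient T (pt x ((invRadius T h x a)⁻¹ • a))) a (invRadius T h x a)
      (fderiv ℝ h x)

theorem IsSlaterRadius.hasFDerivAt_invRadius_gradient (hR : IsSlaterRadius T h x₀ δ r₀)
    (hT : ConvexOn ℝ univ T) {x : H} (hx : x ∈ Metric.ball x₀ δ) (hh : DifferentiableAt ℝ h x)
    {a : Rm m} (ha : a ≠ 0) (ht : 0 < invRadius T h x a)
    (hd : DifferentiableAt ℝ T (pt x ((invRadius T h x a)⁻¹ • a))) :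
    HasFDerivAt (fun y => invRadius T h y a)
      (invRadiusDeriv (gradient T (pt x ((invRadius T h x a)⁻¹ • a))) a (invRadius T h x a)
        (fderiv ℝ h x)) x :=
  hR.hasFDerivAt_invRadius hT (continuous_of_convexOn hT) hx ha ht (gradient_mem_subdiff hT hd)
    hd.hasGradientAt.hasFDerivAt hh.hasFDerivAt

/-- Where `τ > 0` this is the chain rule. Where `τ = 0` the inverse radius need not be
differentiable, but the outer function has derivative zero there and `τ` is Lipschitz. -/
theorem IsSlaterRadius.hasFDerivAt_radialMass (hR : IsSlaterRadius T h x₀ δ r₀) (hm : 0 < m)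
    (hf : Continuous f)
    (htail : Tendsto (fun z => ‖z‖ ^ (m + 1) * f z) (Bornology.cobounded (Rm m)) (𝓝 0))
    (hT : ConvexOn ℝ univ T) {x : H} (hx : x ∈ Metric.ball x₀ δ) (hh : DifferentiableAt ℝ h x)
    {a : Rm m} (ha : a ≠ 0)
    (hd : 0 < invRadius T h x a → DifferentiableAt ℝ T (pt x ((invRadius T h x a)⁻¹ • a))) :
    HasFDerivAt (fun y => radialMass T h f y a) (radialMassDeriv T h f x a) x := by
  have hTc := continuous_of_convexOn hT
  have hc := continuous_radialDensity hf htail ha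
  set τ : H → ℝ := fun y => invRadius T h y a with hτ
  have hball : Metric.ball x₀ δ ∈ 𝓝 x := Metric.isOpen_ball.mem_nhds hx
  have hW : HasDerivAt (fun t => (∫ u in Ioi (0 : ℝ), radialDensity f a u) -
      ∫ u in (0 : ℝ)..t, radialDensity f a u) (-radialDensity f a (τ x)) (τ x) :=
    (intervalIntegral.integral_hasDerivAt_right (hc.intervalIntegrable _ _)
      hc.aestronglyMeasurable.stronglyMeasurableAtFilter hc.continuousAt).const_sub _
  have heq : (fun y => radialMass T h f y a) =ᶠ[𝓝 x]
      fun y => (∫ u in Ioi (0 : ℝ), radialDensity f a u) -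
        ∫ u in (0 : ℝ)..τ y, radialDensity f a u := by
    filter_upwards [hball] with y hy using hR.radialMass_eq hm hf htail hT hTc hy ha
  refine HasFDerivAt.congr_of_eventuallyEq ?_ heq
  rcases (invRadius_nonneg (T := T) (h := h) x a).eq_or_lt with h0 | h0
  · have h0' : τ x = 0 := h0.symm
    have hzero : radialMassDeriv T h f x a = 0 := by
      rw [radialMassDeriv, ← h0, radialDensity_zero, neg_zero, zero_smul]
    have hO : (fun y => τ y - τ x) =O[𝓝 x] fun y => y - x := by
      refine Asymptotics.IsBigO.of_bound (‖a‖ / (2 * δ * r₀)) ?_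
      filter_upwards [hball] with y hy
      exact hR.abs_invRadius_sub_le hT hTc hx hy ha
    have hτc : Tendsto τ (𝓝 x) (𝓝 (τ x)) := by
      rw [← tendsto_sub_nhds_zero_iff]
      exact hO.trans_tendsto (tendsto_sub_nhds_zero_iff.2 tendsto_id)
    rw [hzero, hasFDerivAt_iff_isLittleO]
    have hlo := (hasFDerivAt_iff_isLittleO.1 hW.hasFDerivAt).comp_tendsto hτc
    refine (hlo.trans_isBigO hO).congr_left fun y => ?_
    simp [h0', radialDensity_zero]
  · exact hW.comp_hasFDerivAt x (hR.hasFDerivAt_invRadius_gradient hT hx hh ha h0 (hd h0))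

/-- The derivative of `τ` is bounded by its Lipschitz constant. The density is kept as a factor
because it tends to `0` as `τ → 0`. -/
theorem IsSlaterRadius.norm_radialMassDeriv_le (hR : IsSlaterRadius T h x₀ δ r₀)
    (hT : ConvexOn ℝ univ T) {x : H} (hx : x ∈ Metric.ball x₀ δ) (hh : DifferentiableAt ℝ h x)
    {a : Rm m} (ha : a ≠ 0)
    (hd : 0 < invRadius T h x a → DifferentiableAt ℝ T (pt x ((invRadius T h x a)⁻¹ • a))) :
    ‖radialMassDeriv T h f x a‖ ≤
      |radialDensity f a (invRadius T h x a)| * (‖a‖ / (2 * δ * r₀)) := by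
  have hδ := hR.pos
  have hr := hR.r_pos
  rcases (invRadius_nonneg (T := T) (h := h) x a).eq_or_lt with h0 | h0
  · rw [radialMassDeriv, ← h0, radialDensity_zero]
    simp
  · rw [radialMassDeriv, norm_smul, norm_neg, Real.norm_eq_abs]
    gcongr
    refine (hR.hasFDerivAt_invRadius_gradient hT hx hh ha h0 (hd h0)).le_of_lip' (by positivity) ?_
    filter_upwards [Metric.isOpen_ball.mem_nhds hx] with y hy
    exact hR.abs_invRadius_sub_le hT (continuous_of_convexOn hT) hx hy ha

variable {ι : Type*} {l : Filter ι} {S : WithLp 2 (H × Rm m) → ℝ}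
  {Tk : ι → WithLp 2 (H × Rm m) → ℝ} {xk : ι → H}

/-- At `x₀` the limit is bounded above by monotonicity in `T`, and below because a point strictly
infeasible for `S` is eventually infeasible for `Tk`. The common Lipschitz constant then allows the
base point to move. -/
theorem tendsto_invRadius (hS : ConvexOn ℝ univ S) (hRS : IsSlaterRadius S h x₀ δ r₀)
    (hTk : ∀ k, ConvexOn ℝ univ (Tk k)) (hle : ∀ k p, Tk k p ≤ S p)
    (hRk : ∀ k, IsSlaterRadius (Tk k) h x₀ δ r₀)
    (hlim : ∀ p, Tendsto (fun k => Tk k p) l (𝓝 (S p))) (hx : Tendsto xk l (𝓝 x₀))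
    {a : Rm m} (ha : a ≠ 0) :
    Tendsto (fun k => invRadius (Tk k) h (xk k) a) l (𝓝 (invRadius S h x₀ a)) := by
  have hx₀ : x₀ ∈ Metric.ball x₀ δ := Metric.mem_ball_self hRS.pos
  have hbase : Tendsto (fun k => invRadius (Tk k) h x₀ a) l (𝓝 (invRadius S h x₀ a)) := by
    refine tendsto_order.2 ⟨fun c hc => ?_, fun c hc => Eventually.of_forall fun k =>
      (invRadius_mono (hle k) hRS hx₀ ha).trans_lt hc⟩
    rcases lt_or_ge c 0 with hc0 | hc0
    · exact Eventually.of_forall fun k => hc0.trans_le (invRadius_nonneg x₀ a)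
    obtain ⟨d, hcd, hd⟩ := exists_between hc
    have hd0 : 0 < d := hc0.trans_lt hcd
    have h1 : h x₀ < S (pt x₀ (d⁻¹ • a)) := by
      by_contra! hcon
      exact absurd ((hRS.invRadius_le_iff hS (continuous_of_convexOn hS) hx₀ ha hd0).2 hcon)
        (not_le.2 hd)
    filter_upwards [(hlim (pt x₀ (d⁻¹ • a))).eventually (lt_mem_nhds h1)] with k hk
    by_contra! hcon
    exact absurd (((hRk k).invRadius_le_iff (hTk k) (continuous_of_convexOn (hTk k)) hx₀ ha
      hd0).1 (hcon.trans hcd.le)) (not_le.2 hk)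
  have hdiff : Tendsto (fun k => invRadius (Tk k) h (xk k) a - invRadius (Tk k) h x₀ a) l
      (𝓝 0) := by
    have h1 : Tendsto (fun k => ‖a‖ / (2 * δ * r₀) * ‖xk k - x₀‖) l (𝓝 0) := by
      simpa using (tendsto_iff_norm_sub_tendsto_zero.1 hx).const_mul (‖a‖ / (2 * δ * r₀))
    refine squeeze_zero_norm' ?_ h1
    filter_upwards [hx (Metric.ball_mem_nhds x₀ hRS.pos)] with k hk
    exact (hRk k).abs_invRadius_sub_le (hTk k) (continuous_of_convexOn (hTk k)) hx₀ hk ha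
  simpa using hdiff.add hbase

/-- On rays with `τ = 0` the norm bound tends to zero with the density. On the others the gradients
at the moving boundary points converge to the unique subgradient of `S`, and transversality keeps
the limiting denominator positive. -/
theorem tendsto_radialMassDeriv (hf : Continuous f)
    (htail : Tendsto (fun z => ‖z‖ ^ (m + 1) * f z) (Bornology.cobounded (Rm m)) (𝓝 0))
    (hS : ConvexOn ℝ univ S) (hRS : IsSlaterRadius S h x₀ δ r₀) (hh : ContDiff ℝ 1 h)
    (hTk : ∀ k, ConvexOn ℝ univ (Tk k)) (hTd : ∀ k, Differentiable ℝ (Tk k))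
    (hle : ∀ k p, Tk k p ≤ S p) (hRk : ∀ k, IsSlaterRadius (Tk k) h x₀ δ r₀)
    (hlim : ∀ (p : WithLp 2 (H × Rm m)) (pk : ι → WithLp 2 (H × Rm m)), Tendsto pk l (𝓝 p) →
      Tendsto (fun k => Tk k (pk k)) l (𝓝 (S p)))
    (hx : Tendsto xk l (𝓝 x₀)) {a : Rm m} (ha : a ≠ 0)
    (huniq : 0 < invRadius S h x₀ a →
      ∃! s, s ∈ subdiff S (pt x₀ ((invRadius S h x₀ a)⁻¹ • a))) :
    Tendsto (fun k => radialMassDeriv (Tk k) h f (xk k) a) l (𝓝 (radialMassDeriv S h f x₀ a)) := by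
  have hx₀ : x₀ ∈ Metric.ball x₀ δ := Metric.mem_ball_self hRS.pos
  have hτ := tendsto_invRadius hS hRS hTk hle hRk (fun p => hlim p _ tendsto_const_nhds) hx ha
  have hdens := ((continuous_radialDensity hf htail ha).tendsto _).comp hτ
  rcases (invRadius_nonneg (T := S) (h := h) x₀ a).eq_or_lt with h0 | h0
  · have hzero : radialMassDeriv S h f x₀ a = 0 := by
      rw [radialMassDeriv, ← h0, radialDensity_zero, neg_zero, zero_smul]
    rw [hzero]
    rw [← h0, radialDensity_zero] at hdens
    have h1 := hdens.abs.mul_const (‖a‖ / (2 * δ * r₀))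
    rw [abs_zero, zero_mul] at h1
    refine squeeze_zero_norm' ?_ h1
    filter_upwards [hx (Metric.ball_mem_nhds x₀ hRS.pos)] with k hk
    exact (hRk k).norm_radialMassDeriv_le (hTk k) hk (hh.differentiable one_ne_zero _) ha
      fun _ => hTd k _
  · set t := invRadius S h x₀ a with ht
    obtain ⟨s, hs, hsu⟩ := huniq h0
    have hgrad : gradient S (pt x₀ (t⁻¹ • a)) = s :=
      hsu _ (gradient_mem_subdiff hS (hasFDerivAt_of_unique_subgradient hS hs hsu).differentiableAt)
    have hpk : Tendsto (fun k => pt (xk k) ((invRadius (Tk k) h (xk k) a)⁻¹ • a)) l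
        (𝓝 (pt x₀ (t⁻¹ • a))) :=
      (continuous_pt.tendsto (x₀, t⁻¹ • a)).comp
        (hx.prodMk_nhds ((hτ.inv₀ h0.ne').smul_const a))
    have hg : Tendsto (fun k => gradient (Tk k)
        (pt (xk k) ((invRadius (Tk k) h (xk k) a)⁻¹ • a))) l (𝓝 s) :=
      tendsto_subgradient hS hsu (Eventually.of_forall hle) hpk (hlim _ _ hpk)
        (Eventually.of_forall fun k => gradient_mem_subdiff (hTk k) (hTd k _))
    have hpos : 0 < inner ℝ s.snd a := by
      refine inner_snd_pos h0 hs ?_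
      rw [hRS.eq_of_invRadius_pos hS (continuous_of_convexOn hS) hx₀ ha h0]
      exact hRS.slater x₀ hx₀
    have hfst : Continuous fun p : WithLp 2 (H × Rm m) => p.fst := by fun_prop
    have hsnd : Continuous fun p : WithLp 2 (H × Rm m) => p.snd := by fun_prop
    have hh' : Tendsto (fun k => fderiv ℝ h (xk k)) l (𝓝 (fderiv ℝ h x₀)) :=
      ((hh.continuous_fderiv one_ne_zero).tendsto x₀).comp hx
    rw [radialMassDeriv, hgrad]
    refine hdens.neg.smul (Tendsto.smul ?_ (Tendsto.sub ?_ hh'))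
    · exact (hτ.pow 2).div (((hsnd.tendsto s).comp hg).inner tendsto_const_nhds) hpos.ne'
    · exact ((innerSL ℝ).continuous.tendsto _).comp ((hfst.tendsto s).comp hg)

end RadialMass

/-! ### Polar coordinates adapted to `L` -/

section Polar

variable {m : ℕ}

/-- Integration in polar coordinates. -/
theorem integral_polar (hm : 0 < m) {G : Rm m → ℝ} (hG : Integrable G) :
    Integrable (fun v : Sph m => ∫ r in Ioi (0 : ℝ), r ^ (m - 1) * G (r • (v : Rm m)))
      (volume : Measure (Rm m)).toSphere ∧
    ∫ z, G z = ∫ v : Sph m, (∫ r in Ioi (0 : ℝ), r ^ (m - 1) * G (r • (v : Rm m)))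
      ∂(volume : Measure (Rm m)).toSphere := by
  have : Nonempty (Fin m) := ⟨⟨0, hm⟩⟩
  have : Nontrivial (Rm m) := inferInstance
  have hdim : Module.finrank ℝ (Rm m) = m := by simp
  have hmp := (volume : Measure (Rm m)).measurePreserving_homeomorphUnitSphereProd
  rw [hdim] at hmp
  set σ := (volume : Measure (Rm m)).toSphere
  let g : Sph m × Ioi (0 : ℝ) → ℝ := fun q => G (q.2.1 • q.1.1)
  have hg : ∀ z : ({0}ᶜ : Set (Rm m)), g (homeomorphUnitSphereProd (Rm m) z) = G z := by
    intro z
    have h1 := congrArg Subtype.val ((homeomorphUnitSphereProd (Rm m)).symm_apply_apply z)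
    rw [homeomorphUnitSphereProd_symm_apply_coe] at h1
    exact congrArg G h1
  have hme := (homeomorphUnitSphereProd (Rm m)).measurableEmbedding
  have hcompl : MeasurableSet ({0}ᶜ : Set (Rm m)) := (measurableSet_singleton _).compl
  have hgi : Integrable g (σ.prod (Measure.volumeIoiPow (m - 1))) := by
    rw [← hmp.integrable_comp_emb hme]
    have h1 : Integrable (fun z : ({0}ᶜ : Set (Rm m)) => G z)
        ((volume : Measure (Rm m)).comap (↑)) := by
      have := integrableOn_iff_comap_subtypeVal (f := G) (μ := volume) hcompl
      exact this.1 hG.integrableOn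
    exact h1.congr (Eventually.of_forall fun z => (hg z).symm)
  have hinner : ∀ v : Sph m, ∫ r : Ioi (0 : ℝ), g (v, r) ∂(Measure.volumeIoiPow (m - 1))
      = ∫ r in Ioi (0 : ℝ), r ^ (m - 1) * G (r • (v : Rm m)) := by
    intro v
    simp only [Measure.volumeIoiPow, ENNReal.ofReal]
    rw [integral_withDensity_eq_integral_smul
      ((measurable_subtype_coe.pow_const _).real_toNNReal),
      integral_subtype_comap measurableSet_Ioi
        fun r : ℝ => Real.toNNReal (r ^ (m - 1)) • G (r • (v : Rm m))]
    refine setIntegral_congr_fun measurableSet_Ioi fun r hr => ?_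
    have hr0 : (0 : ℝ) < r := hr
    change Real.toNNReal (r ^ (m - 1)) • G (r • (v : Rm m)) = _
    rw [NNReal.smul_def, Real.coe_toNNReal _ (by positivity), smul_eq_mul]
  constructor
  · exact hgi.integral_prod_left.congr (Eventually.of_forall hinner)
  · calc ∫ z, G z = ∫ z : ({0}ᶜ : Set (Rm m)), G z ∂((volume : Measure (Rm m)).comap (↑)) := by
          rw [integral_subtype_comap hcompl G, restrict_compl_singleton]
      _ = ∫ q, g q ∂(σ.prod (Measure.volumeIoiPow (m - 1))) := by
          rw [← hmp.integral_comp hme]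
          exact integral_congr_ae (Eventually.of_forall fun z => (hg z).symm)
      _ = _ := by
          rw [integral_prod _ hgi]
          exact integral_congr_ae (Eventually.of_forall hinner)

theorem det_toEuclideanLin (L : Matrix (Fin m) (Fin m) ℝ) :
    LinearMap.det (Matrix.toEuclideanLin L) = L.det := by
  rw [Matrix.toEuclideanLin_eq_toLin_orthonormal, LinearMap.det_toLin]

theorem toEuclideanLin_ne_zero {L : Matrix (Fin m) (Fin m) ℝ} (hL : L.det ≠ 0) (v : Sph m) :
    Matrix.toEuclideanLin L (v : Rm m) ≠ 0 := by
  intro h0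
  have hu : LinearMap.det (Matrix.toEuclideanLin L) ≠ 0 := by rwa [det_toEuclideanLin]
  have h1 := (LinearMap.equivOfDetNeZero _ hu).injective (a₁ := (v : Rm m)) (a₂ := 0)
    (by simpa using h0)
  exact ne_zero_of_mem_unit_sphere v h1

/-- Integration in polar coordinates adapted to the matrix `L`. -/
theorem integral_polar_linear (hm : 0 < m) {L : Matrix (Fin m) (Fin m) ℝ} (hL : L.det ≠ 0)
    {G : Rm m → ℝ} (hG : Integrable G) :
    Integrable (fun v : Sph m => ∫ r in Ioi (0 : ℝ), r ^ (m - 1) *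
      G (r • Matrix.toEuclideanLin L (v : Rm m))) (volume : Measure (Rm m)).toSphere ∧
    ∫ z, G z = |L.det| * ∫ v : Sph m, (∫ r in Ioi (0 : ℝ), r ^ (m - 1) *
      G (r • Matrix.toEuclideanLin L (v : Rm m))) ∂(volume : Measure (Rm m)).toSphere := by
  have hdet : LinearMap.det (Matrix.toEuclideanLin L) ≠ 0 := by rwa [det_toEuclideanLin]
  have hmap := Measure.map_linearMap_addHaar_eq_smul_addHaar (volume : Measure (Rm m)) hdet
  rw [det_toEuclideanLin] at hmap
  have hme : MeasurableEmbedding (Matrix.toEuclideanLin L) :=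
    (LinearMap.equivOfDetNeZero _ hdet).toContinuousLinearEquiv.toHomeomorph.measurableEmbedding
  have hcomp : Integrable (fun z => G (Matrix.toEuclideanLin L z)) := by
    have h1 : Integrable G (Measure.map (Matrix.toEuclideanLin L) volume) := by
      rw [hmap]; exact hG.smul_measure ENNReal.ofReal_ne_top
    exact hme.integrable_map_iff.1 h1
  have hint : ∫ z, G z = |L.det| * ∫ z, G (Matrix.toEuclideanLin L z) := by
    rw [← hme.integral_map, hmap, integral_smul_measure, smul_eq_mul,
      ENNReal.toReal_ofReal (abs_nonneg _), abs_inv, mul_inv_cancel_left₀ (abs_ne_zero.2 hL)]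
  obtain ⟨h1, h2⟩ := integral_polar hm hcomp
  simp only [map_smul] at h1 h2
  exact ⟨h1, by rw [hint, h2]⟩

end Polar

/-! ### Measurability of parametric derivatives -/

section Parametric

variable {α : Type*} [MeasurableSpace α] {μ : Measure α}
variable {H : Type*} [NormedAddCommGroup H] [InnerProductSpace ℝ H] [FiniteDimensional ℝ H]

/-- Each directional derivative is an almost everywhere limit of measurable difference quotients;
finitely many basis directions recover the linear form. -/
theorem aestronglyMeasurable_of_hasFDerivAt {F : H → α → ℝ} {F' : α → H →L[ℝ] ℝ} {x : H}
    {s : Set H} (hs : s ∈ 𝓝 x) (hF : ∀ y ∈ s, AEStronglyMeasurable (F y) μ)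
    (hd : ∀ᵐ a ∂μ, HasFDerivAt (fun y => F y a) (F' a) x) : AEStronglyMeasurable F' μ := by
  have hdir : ∀ e : H, AEStronglyMeasurable (fun a => F' a e) μ := by
    intro e
    have hsmall : ∀ᶠ n : ℕ in atTop, x + ((n : ℝ) + 1)⁻¹ • e ∈ s := by
      have h1 : Tendsto (fun n : ℕ => x + ((n : ℝ) + 1)⁻¹ • e) atTop (𝓝 (x + (0 : ℝ) • e)) := by
        refine tendsto_const_nhds.add (Tendsto.smul_const ?_ e)
        simpa using tendsto_one_div_add_atTop_nhds_zero_nat (𝕜 := ℝ)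
      rw [zero_smul, add_zero] at h1
      exact h1 hs
    obtain ⟨N, hN⟩ := eventually_atTop.1 hsmall
    -- The shift by `N` keeps all sample points in `s`, where measurability is known.
    refine aestronglyMeasurable_of_tendsto_ae atTop
      (f := fun (n : ℕ) a => (((n + N : ℕ) : ℝ) + 1) *
        (F (x + (((n + N : ℕ) : ℝ) + 1)⁻¹ • e) a - F x a)) (fun n => ?_) ?_
    · exact ((hF _ (hN _ (by omega))).sub (hF x (mem_of_mem_nhds hs))).const_mul _
    · filter_upwards [hd] with a ha
      exact (ha.lim_real e).comp (tendsto_atTop_add_const_right _ _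
        (tendsto_natCast_atTop_atTop.comp (tendsto_add_atTop_nat N)))
  let b := stdOrthonormalBasis ℝ H
  have hsum : F' = fun a => ∑ i, F' a (b i) • innerSL ℝ (b i) := by
    funext a
    ext y
    conv_lhs => rw [← b.sum_repr' y]
    simp [mul_comm]
  rw [hsum]
  refine Finset.aestronglyMeasurable_fun_sum _ fun i _ => ?_
  exact (hdir (b i)).smul_const _

end Parametric

/-! ### Spherical radial decomposition and differentiation under the integral -/

section Probability

variable {Ω : Type*} [MeasurableSpace Ω] {P : Measure Ω} [IsProbabilityMeasure P] {m : ℕ}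
variable {ξ : Ω → Rm m} {f : Rm m → ℝ}

theorem integrable_of_density (hξ : Measurable ξ) (hf : Continuous f) (hf0 : ∀ z, 0 ≤ f z)
    (hdens : P.map ξ = (volume : Measure (Rm m)).withDensity (fun z => ENNReal.ofReal (f z))) :
    Integrable f := by
  refine ⟨hf.aestronglyMeasurable, ?_⟩
  rw [hasFiniteIntegral_iff_ofReal (Eventually.of_forall hf0)]
  have h1 : (P.map ξ) univ = 1 := by
    rw [Measure.map_apply hξ MeasurableSet.univ, preimage_univ, measure_univ]
  rw [hdens, withDensity_apply _ MeasurableSet.univ, Measure.restrict_univ] at h1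
  rw [h1]
  exact ENNReal.one_lt_top

theorem measureReal_preimage_eq_integral (hξ : Measurable ξ) (hf : Continuous f)
    (hf0 : ∀ z, 0 ≤ f z)
    (hdens : P.map ξ = (volume : Measure (Rm m)).withDensity (fun z => ENNReal.ofReal (f z)))
    {A : Set (Rm m)} (hA : MeasurableSet A) : P.real (ξ ⁻¹' A) = ∫ z, A.indicator f z := by
  have hfi := integrable_of_density hξ hf hf0 hdens
  rw [integral_indicator hA, Measure.real, ← Measure.map_apply hξ hA, hdens,
    withDensity_apply _ hA, ← ofReal_integral_eq_lintegral_ofReal hfi.integrableOn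
      (Eventually.of_forall hf0), ENNReal.toReal_ofReal (integral_nonneg hf0)]

variable {H : Type*} [NormedAddCommGroup H] [InnerProductSpace ℝ H]

/-- The probability that `T(x, ξ) ≤ h(x)`. -/
noncomputable def feasProb (P : Measure Ω) (ξ : Ω → Rm m) (T : WithLp 2 (H × Rm m) → ℝ)
    (h : H → ℝ) (x : H) : ℝ :=
  P.real {ω | T (pt x (ξ ω)) ≤ h x}

variable {T : WithLp 2 (H × Rm m) → ℝ} {h : H → ℝ} {x₀ : H} {δ r₀ κ : ℝ}
variable {L : Matrix (Fin m) (Fin m) ℝ}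

/-- The spherical radial decomposition of the probability function. -/
theorem feasProb_eq (hm : 0 < m) (hξ : Measurable ξ) (hf : Continuous f) (hf0 : ∀ z, 0 ≤ f z)
    (hdens : P.map ξ = (volume : Measure (Rm m)).withDensity (fun z => ENNReal.ofReal (f z)))
    (hL : L.det ≠ 0) (hTc : Continuous T) (x : H) :
    Integrable (fun v : Sph m => radialMass T h f x (Matrix.toEuclideanLin L (v : Rm m)))
      (volume : Measure (Rm m)).toSphere ∧
    feasProb P ξ T h x = |L.det| *
      ∫ v : Sph m, radialMass T h f x (Matrix.toEuclideanLin L (v : Rm m))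
        ∂(volume : Measure (Rm m)).toSphere := by
  have hA : MeasurableSet {z : Rm m | T (pt x z) ≤ h x} :=
    (isClosed_le (hTc.comp (continuous_pt.comp (Continuous.prodMk_right x)))
      continuous_const).measurableSet
  obtain ⟨h1, h2⟩ := integral_polar_linear hm hL
    ((integrable_of_density hξ hf hf0 hdens).indicator hA)
  exact ⟨h1, (measureReal_preimage_eq_integral hξ hf hf0 hdens hA).trans h2⟩

/-- On the compact sphere `‖L v‖` is continuous and never zero, so the ray-wise Lipschitz constants
are bounded. -/
theorem exists_radialMass_lipschitz_bound (hL : L.det ≠ 0) (B δ r₀ : ℝ) :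
    ∃ κ : ℝ, 0 ≤ κ ∧ ∀ v : Sph m, ‖Matrix.toEuclideanLin L (v : Rm m)‖⁻¹ ^ (m + 1) * B *
      (‖Matrix.toEuclideanLin L (v : Rm m)‖ / (2 * δ * r₀)) ≤ κ := by
  have hc : Continuous fun v : Sph m => ‖Matrix.toEuclideanLin L (v : Rm m)‖ :=
    ((Matrix.toEuclideanLin L).continuous_of_finiteDimensional.comp continuous_subtype_val).norm
  have hc' : Continuous fun v : Sph m => ‖Matrix.toEuclideanLin L (v : Rm m)‖⁻¹ ^ (m + 1) * B *
      (‖Matrix.toEuclideanLin L (v : Rm m)‖ / (2 * δ * r₀)) :=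
    (((hc.inv₀ fun v => norm_ne_zero_iff.2 (toEuclideanLin_ne_zero hL v)).pow _).mul_const _).mul
      (hc.div_const _)
  obtain ⟨κ, hκ⟩ := (isCompact_univ (X := Sph m)).exists_bound_of_continuousOn hc'.continuousOn
  exact ⟨max κ 0, le_max_right _ _, fun v =>
    (le_abs_self _).trans ((hκ v (mem_univ v)).trans (le_max_left _ _))⟩

/-- The Lipschitz constant `κ` serves the mass carried by each ray of the decomposition. -/
def RadialLipschitz (T : WithLp 2 (H × Rm m) → ℝ) (h : H → ℝ) (f : Rm m → ℝ)
    (L : Matrix (Fin m) (Fin m) ℝ) (x₀ : H) (δ κ : ℝ) : Prop :=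
  ∀ v : Sph m, ∀ x ∈ Metric.ball x₀ δ, ∀ y ∈ Metric.ball x₀ δ,
    |radialMass T h f y (Matrix.toEuclideanLin L (v : Rm m)) -
      radialMass T h f x (Matrix.toEuclideanLin L (v : Rm m))| ≤ κ * ‖y - x‖

theorem lipschitzOnWith_feasProb (hm : 0 < m) (hξ : Measurable ξ) (hf : Continuous f)
    (hf0 : ∀ z, 0 ≤ f z)
    (hdens : P.map ξ = (volume : Measure (Rm m)).withDensity (fun z => ENNReal.ofReal (f z)))
    (hL : L.det ≠ 0) (hTc : Continuous T) (hlip : RadialLipschitz T h f L x₀ δ κ) :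
    ∃ c : ℝ≥0, LipschitzOnWith c (feasProb P ξ T h) (Metric.ball x₀ δ) := by
  set σ := (volume : Measure (Rm m)).toSphere
  refine ⟨Real.toNNReal (|L.det| * (κ * σ.real univ)), LipschitzOnWith.of_dist_le_mul
    fun y hy x hx => ?_⟩
  obtain ⟨ix, ex⟩ := feasProb_eq (h := h) hm hξ hf hf0 hdens hL hTc x
  obtain ⟨iy, ey⟩ := feasProb_eq (h := h) hm hξ hf hf0 hdens hL hTc y
  rw [Real.dist_eq, ex, ey, ← mul_sub, ← integral_sub iy ix, abs_mul, abs_abs, dist_eq_norm]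
  have h1 := norm_integral_le_of_norm_le_const (μ := σ)
    (f := fun v : Sph m => radialMass T h f y (Matrix.toEuclideanLin L (v : Rm m)) -
      radialMass T h f x (Matrix.toEuclideanLin L (v : Rm m))) (C := κ * ‖y - x‖)
    (Eventually.of_forall fun v => hlip v x hx y hy)
  refine (mul_le_mul_of_nonneg_left h1 (abs_nonneg _)).trans ?_
  calc |L.det| * (κ * ‖y - x‖ * σ.real univ) = |L.det| * (κ * σ.real univ) * ‖y - x‖ := by ring
    _ ≤ _ := mul_le_mul_of_nonneg_right (Real.le_coe_toNNReal _) (norm_nonneg _)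

variable [FiniteDimensional ℝ H]

/-- The constant `κ`, integrable on the sphere, dominates the difference quotients of all ray
masses. -/
theorem IsSlaterRadius.hasFDerivAt_feasProb (hR : IsSlaterRadius T h x₀ δ r₀) (hm : 0 < m)
    (hξ : Measurable ξ) (hf : Continuous f) (hf0 : ∀ z, 0 ≤ f z)
    (hdens : P.map ξ = (volume : Measure (Rm m)).withDensity (fun z => ENNReal.ofReal (f z)))
    (htail : Tendsto (fun z => ‖z‖ ^ (m + 1) * f z) (Bornology.cobounded (Rm m)) (𝓝 0))
    (hL : L.det ≠ 0) (hT : ConvexOn ℝ univ T) (hlip : RadialLipschitz T h f L x₀ δ κ)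
    {x : H} (hx : x ∈ Metric.ball x₀ δ) (hh : DifferentiableAt ℝ h x)
    (hd : ∀ᵐ v : Sph m ∂(volume : Measure (Rm m)).toSphere,
      0 < invRadius T h x (Matrix.toEuclideanLin L (v : Rm m)) → DifferentiableAt ℝ T
        (pt x ((invRadius T h x (Matrix.toEuclideanLin L (v : Rm m)))⁻¹ •
          Matrix.toEuclideanLin L (v : Rm m)))) :
    Integrable (fun v : Sph m => radialMassDeriv T h f x (Matrix.toEuclideanLin L (v : Rm m)))
      (volume : Measure (Rm m)).toSphere ∧
    HasFDerivAt (feasProb P ξ T h) (|L.det| •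
      ∫ v : Sph m, radialMassDeriv T h f x (Matrix.toEuclideanLin L (v : Rm m))
        ∂(volume : Measure (Rm m)).toSphere) x := by
  have hTc := continuous_of_convexOn hT
  have hball : Metric.ball x₀ δ ∈ 𝓝 x := Metric.isOpen_ball.mem_nhds hx
  have hmass := feasProb_eq (T := T) (h := h) hm hξ hf hf0 hdens hL hTc
  have hder : ∀ᵐ v : Sph m ∂(volume : Measure (Rm m)).toSphere,
      HasFDerivAt (fun y => radialMass T h f y (Matrix.toEuclideanLin L (v : Rm m)))
        (radialMassDeriv T h f x (Matrix.toEuclideanLin L (v : Rm m))) x := by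
    filter_upwards [hd] with v hv
    exact hR.hasFDerivAt_radialMass hm hf htail hT hx hh (toEuclideanLin_ne_zero hL v) hv
  obtain ⟨h1, h2⟩ := hasFDerivAt_integral_of_dominated_loc_of_lip'
    (μ := (volume : Measure (Rm m)).toSphere)
    (F := fun y (v : Sph m) => radialMass T h f y (Matrix.toEuclideanLin L (v : Rm m)))
    (F' := fun v : Sph m => radialMassDeriv T h f x (Matrix.toEuclideanLin L (v : Rm m)))
    (bound := fun _ => κ) hball (fun y _ => (hmass y).1.aestronglyMeasurable) (hmass x).1
    (aestronglyMeasurable_of_hasFDerivAt hball (fun y _ => (hmass y).1.aestronglyMeasurable) hder)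
    (Eventually.of_forall fun v y hy => hlip v x hx y hy) (integrable_const κ) hder
  refine ⟨h1, (h2.const_mul |L.det|).congr_of_eventuallyEq ?_⟩
  exact Eventually.of_forall fun y => (hmass y).2

end Probability

/-- Transfers the uniqueness of subgradients, assumed at the radius `ρ`, to the inverse radius. -/
theorem IsSlaterRadius.rho_eq {H : Type*} [NormedAddCommGroup H] [InnerProductSpace ℝ H] {m : ℕ}
    {T : WithLp 2 (H × Rm m) → ℝ} {h : H → ℝ} {x₀ : H} {δ r₀ : ℝ}
    (hR : IsSlaterRadius T h x₀ δ r₀) (hT : ConvexOn ℝ univ T) (hTc : Continuous T)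
    {L : Matrix (Fin m) (Fin m) ℝ} {v : Sph m} (ha : Matrix.toEuclideanLin L (v : Rm m) ≠ 0)
    (hpos : 0 < invRadius T h x₀ (Matrix.toEuclideanLin L (v : Rm m))) :
    rho T h L x₀ v = (invRadius T h x₀ (Matrix.toEuclideanLin L (v : Rm m)))⁻¹ := by
  have hx₀ : x₀ ∈ Metric.ball x₀ δ := Metric.mem_ball_self hR.pos
  refine IsGreatest.csSup_eq ⟨⟨inv_pos.2 hpos,
    (hR.eq_of_invRadius_pos hT hTc hx₀ ha hpos).le⟩, ?_⟩
  rintro r ⟨hr, hle⟩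
  refine (le_inv_comm₀ hr hpos).2
    ((hR.invRadius_le_iff hT hTc hx₀ ha (inv_pos.2 hr)).2 ?_)
  rw [inv_inv]
  exact hle

end ConicChance

/-! ### The gradient consistency theorem -/

open ConicChance

theorem mainTheorem4
    {Ω : Type*} [MeasurableSpace Ω] (P : Measure Ω) [IsProbabilityMeasure P]
    {H : Type*} [NormedAddCommGroup H] [InnerProductSpace ℝ H] [FiniteDimensional ℝ H]
    {Y : Type*} [NormedAddCommGroup Y] [NormedSpace ℝ Y] [CompleteSpace Y]
    {m : ℕ} (hm : 0 < m)
    -- the random vector and its continuous density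
    (ξ : Ω → ConicChance.Rm m) (hξ : Measurable ξ)
    (f : ConicChance.Rm m → ℝ) (hf_cont : Continuous f) (hf_nonneg : ∀ z, 0 ≤ f z)
    (hf_dens : P.map ξ = (volume : Measure (ConicChance.Rm m)).withDensity
      (fun z => ENNReal.ofReal (f z)))
    (hf_tail : Tendsto (fun z => ‖z‖ ^ (m + 1) * f z)
      (Bornology.cobounded (ConicChance.Rm m)) (𝓝 0))
    -- the nonsingular matrix of the spherical radial decomposition
    (L : Matrix (Fin m) (Fin m) ℝ) (hL : L.det ≠ 0)
    -- the cone, the generating set of its polar, and the constraint mapping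
    (K : ProperCone ℝ Y)
    (C : Set (WeakDual ℝ Y)) (hC_ne : C.Nonempty) (hC_comp : IsCompact C)
    (hC_conv : Convex ℝ C) (hC_gen : ConicChance.GeneratesPolar C K)
    (Φ : H → ConicChance.Rm m → Y)
    (h : H → ℝ) (hh_smooth : ContDiff ℝ 1 h) (hh_conv : ConvexOn ℝ univ h)
    (hΦ : ∀ w ∈ C, ConvexOn ℝ univ
      (fun p : H × ConicChance.Rm m => w (Φ p.1 p.2) + h p.1))
    -- the reference point
    (x₀ : H)
    (h_slater : ConicChance.supFun C Φ h (ConicChance.pt x₀ 0) < h x₀)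
    (h_growth : ∀ v₀ ∈ ConicChance.infDir (ConicChance.supFun C Φ h) h L x₀,
      ConicChance.EtaGrowth (ConicChance.supFun C Φ h) L f x₀ v₀)
    (h_single : ∀ᵐ v ∂((volume : Measure (ConicChance.Rm m)).toSphere),
      v ∈ ConicChance.finDir (ConicChance.supFun C Φ h) h L x₀ →
        ∃! s, s ∈ ConicChance.subdiff (ConicChance.supFun C Φ h)
          (ConicChance.pt x₀ (ConicChance.ray L
            (ConicChance.rho (ConicChance.supFun C Φ h) h L x₀ v) v))) :
    (∃ κ : ℝ≥0, ∃ U ∈ 𝓝 x₀, LipschitzOnWith κ (ConicChance.prob P ξ Φ K) U) ∧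
    DifferentiableAt ℝ (ConicChance.prob P ξ Φ K) x₀ ∧
    ∀ (lam : ℕ → ℝ) (x : ℕ → H), (∀ k, 0 < lam k) → Tendsto lam atTop (𝓝 0) →
      Tendsto x atTop (𝓝 x₀) →
      (∀ᶠ k in atTop, DifferentiableAt ℝ
        (ConicChance.probReg P ξ (ConicChance.supFun C Φ h) h (lam k)) (x k)) ∧
      ∀ g : H, MapClusterPt g atTop
        (fun k => gradient
          (ConicChance.probReg P ξ (ConicChance.supFun C Φ h) h (lam k)) (x k)) →
        g = gradient (ConicChance.prob P ξ Φ K) x₀ := by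
  set S := supFun C Φ h with hSdef
  have hS : ConvexOn ℝ univ S := convexOn_supFun hC_ne hC_comp hΦ
  have hSc : Continuous S := continuous_of_convexOn hS
  have hprob : prob P ξ Φ K = feasProb P ξ S h := by
    funext x
    have : {ω | -(Φ x (ξ ω)) ∈ K} = {ω | S (pt x (ξ ω)) ≤ h x} := by
      ext ω
      exact neg_mem_iff_supFun_le hC_ne hC_comp hC_gen Φ h x (ξ ω)
    rw [prob, this, feasProb]
  have hreg : ∀ lam : ℝ, probReg P ξ S h lam = feasProb P ξ (moreau S lam) h := fun _ => rfl
  rw [hprob]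
  obtain ⟨δ, r₀, hδ, hSlater⟩ := exists_isSlaterRadius hSc hh_smooth h_slater
  have hRS := hSlater S hS fun _ => le_rfl
  have hx₀ : x₀ ∈ Metric.ball x₀ δ := Metric.mem_ball_self hδ
  have hhd : Differentiable ℝ h := hh_smooth.differentiable one_ne_zero
  obtain ⟨B, -, hB⟩ := exists_bound_of_tendsto_cobounded
    (show Continuous fun z : Rm m => ‖z‖ ^ (m + 1) * f z by fun_prop) hf_tail
  obtain ⟨κ, hκ0, hκ⟩ := exists_radialMass_lipschitz_bound hL B δ r₀
  -- A single `κ` for all convex minorants of `S`: it is both the Lipschitz constant of the limit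
  -- and the majorant for the whole sequence of envelopes.
  have hlip : ∀ T : WithLp 2 (H × Rm m) → ℝ, ConvexOn ℝ univ T → (∀ p, T p ≤ S p) →
      RadialLipschitz T h f L x₀ δ κ := fun T hT hTS v x hx y hy =>
    ((hSlater T hT hTS).abs_radialMass_sub_le hm hf_cont hf_tail hB hT
      (continuous_of_convexOn hT) hx hy (toEuclideanLin_ne_zero hL v)).trans
      (mul_le_mul_of_nonneg_right (hκ v) (norm_nonneg _))
  have hlipS := hlip S hS fun _ => le_rfl
  have hsing : ∀ᵐ v : Sph m ∂(volume : Measure (Rm m)).toSphere,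
      0 < invRadius S h x₀ (Matrix.toEuclideanLin L (v : Rm m)) →
        ∃! s, s ∈ subdiff S (pt x₀ ((invRadius S h x₀ (Matrix.toEuclideanLin L (v : Rm m)))⁻¹ •
          Matrix.toEuclideanLin L (v : Rm m))) := by
    filter_upwards [h_single] with v hv hpos
    have ha := toEuclideanLin_ne_zero hL v
    have hfin : v ∈ finDir S h L x₀ :=
      ⟨_, inv_pos.2 hpos, hRS.eq_of_invRadius_pos hS hSc hx₀ ha hpos⟩
    rw [← hRS.rho_eq hS hSc ha hpos]
    exact hv hfin
  obtain ⟨hintS, hderS⟩ := hRS.hasFDerivAt_feasProb hm hξ hf_cont hf_nonneg hf_dens hf_tail hL hS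
    hlipS hx₀ (hhd x₀) (by
      filter_upwards [hsing] with v hv hpos
      obtain ⟨s, hs, hsu⟩ := hv hpos
      exact (hasFDerivAt_of_unique_subgradient hS hs hsu).differentiableAt)
  obtain ⟨c, hc⟩ := lipschitzOnWith_feasProb hm hξ hf_cont hf_nonneg hf_dens hL hSc hlipS
  refine ⟨⟨c, _, Metric.ball_mem_nhds x₀ hδ, hc⟩, hderS.differentiableAt, ?_⟩
  intro lam x hlam0 hlam hx
  have hTk : ∀ k, ConvexOn ℝ univ (moreau S (lam k)) := fun k => convexOn_moreau hS (hlam0 k)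
  have hTd : ∀ k, Differentiable ℝ (moreau S (lam k)) := fun k =>
    differentiable_moreau hS (hlam0 k)
  have hle : ∀ k p, moreau S (lam k) p ≤ S p := fun k => moreau_le_self hS (hlam0 k)
  have hRk := fun k => hSlater _ (hTk k) (hle k)
  have hderk : ∀ k, x k ∈ Metric.ball x₀ δ → _ := fun k hk =>
    (hRk k).hasFDerivAt_feasProb hm hξ hf_cont hf_nonneg hf_dens hf_tail hL (hTk k)
      (hlip _ (hTk k) (hle k)) hk (hhd (x k)) (Eventually.of_forall fun v _ => hTd k _)
  have hxball : ∀ᶠ k in atTop, x k ∈ Metric.ball x₀ δ := hx (Metric.ball_mem_nhds x₀ hδ)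
  refine ⟨?_, fun g hg => ?_⟩
  · filter_upwards [hxball] with k hk
    exact (hderk k hk).2.differentiableAt
  have hint : Tendsto (fun k => ∫ v : Sph m, radialMassDeriv (moreau S (lam k)) h f (x k)
      (Matrix.toEuclideanLin L (v : Rm m)) ∂(volume : Measure (Rm m)).toSphere) atTop
      (𝓝 (∫ v : Sph m, radialMassDeriv S h f x₀
        (Matrix.toEuclideanLin L (v : Rm m)) ∂(volume : Measure (Rm m)).toSphere)) := by
    refine tendsto_integral_filter_of_dominated_convergence (fun _ => κ) ?_ ?_
      (integrable_const κ) ?_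
    · filter_upwards [hxball] with k hk using (hderk k hk).1.aestronglyMeasurable
    · filter_upwards [hxball] with k hk
      refine Eventually.of_forall fun v => ?_
      refine ((hRk k).hasFDerivAt_radialMass hm hf_cont hf_tail (hTk k) hk (hhd _)
        (toEuclideanLin_ne_zero hL v) fun _ => hTd k _).le_of_lip' hκ0 ?_
      filter_upwards [Metric.isOpen_ball.mem_nhds hk] with y hy
      exact hlip _ (hTk k) (hle k) v _ hk y hy
    · filter_upwards [hsing] with v hv
      exact tendsto_radialMassDeriv hf_cont hf_tail hS hRS hh_smooth hTk hTd hle hRk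
        (fun p pk hp => tendsto_moreau hS hlam0 hlam hp) hx (toEuclideanLin_ne_zero hL v) hv
  -- The whole sequence of gradients converges, so each accumulation point is the limit.
  have hgrad : Tendsto (fun k => gradient (probReg P ξ S h (lam k)) (x k)) atTop
      (𝓝 (gradient (feasProb P ξ S h) x₀)) := by
    have h1 := ((InnerProductSpace.toDual ℝ H).symm.continuous.tendsto _).comp
      (hint.const_smul |L.det|)
    rw [gradient, hderS.fderiv]
    refine h1.congr' ?_
    filter_upwards [hxball] with k hk
    rw [hreg, gradient, (hderk k hk).2.fderiv]
    rfl
  obtain ⟨u, hu, hug⟩ := mapClusterPt_iff_ultrafilter.1 hg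
  exact tendsto_nhds_unique hug (hgrad.mono_left hu)
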